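/- Let $X$ be a complex Hilbert space with complete orthonormal basis $|0\rangle,|1\rangle,|2\rangle,\dots$. On finite linear combinations of basis vectors let $z|n\rangle=\sqrt n\,|n-1\rangle$, $z^*|n\rangle=\sqrt{n+1}\,|n+1\rangle$ and $\zeta=z^*z$, so that $f(\zeta)|n\rangle=f(n)|n\rangle$ for every function $f$ on $\{0,1,2,\dots\}$. For an integer $k\ge 0$ and $\lambda\in\mathbb R$ put $$f_k^\lambda(\zeta)=\frac{(-\lambda^2)^{k/2}}{2^k\,k!}\,e^{-\lambda^2/8}\,\Phi\!\left(-\zeta,1+k;\tfrac{\lambda^2}{4}\right),\qquad \Phi(a,b;x)=\sum_{j\ge 0}\frac{(a)_j}{(b)_j}\frac{x^j}{j!},$$ with the principal value of the power, and for $k\in\mathbb Z$ put $D_k^\lambda=z^{*k}f_k^\lambda(\zeta)$ if $k\ge 0$ and $D_k^\lambda=f_{-k}^\lambda(\zeta)z^{-k}$ if $k\le 0$. Let $K$ be the Hilbert space of Hilbert--Schmidt operators on $X$ with scalar product $(F,G)=\mathrm{tr}(F^*G)$. Then $$(D_k^\lambda,D_n^{\lambda'})=\delta_{kn}\,\delta\!\left(\tfrac{\lambda^2-\lambda'^2}{4}\right)=4\,\delta_{kn}\,\delta(\lambda^2-\lambda'^2)\qquad(k,n\in\mathbb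 Z)$$ in the sense of distributions in the squared weights on $(0,\infty)$. Precisely, for all $k,n\in\mathbb Z$ and all $\varphi,\psi\in C_c^\infty((0,\infty);\mathbb C)$, extended by $0$ to $\mathbb R$: 1. If $k\ne n$, then $\sum_{m\ge 0}\langle D_k^\lambda m,D_n^{\lambda'}m\rangle=0$ for all $\lambda,\lambda'\in\mathbb R$ (here $D_k^\lambda m$ denotes $D_k^\lambda|m\rangle$, and the inner product is conjugate-linear in the first argument). 2. For every $\lambda\in\mathbb R$, $$\sum_{m\ge 0}\int_0^\infty \varphi(s)\,\langle D_k^\lambda m,D_n^{\sqrt s}m\rangle\,ds=4\,\delta_{kn}\,\varphi(\lambda^2),$$ where the integrals and the sum converge absolutely. 3. The smeared basis element $D_k[\varphi]=\int_0^\infty\varphi(s)\,D_k^{\sqrt s}\,ds$, the integral being taken on finite linear combinations of the basis vectors, extends uniquely to a bounded operator on $X$; it belongs to $K$, and $$(D_k[\varphi],D_n[\psi])=4\,\delta_{kn}\int_0^\infty\overline{\varphi(s)}\,\psi(s)\,ds .$$ -/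

import Mathlib

open MeasureTheory Set
open scoped InnerProductSpace ContDiff

noncomputable section

namespace Heisenberg

/-- The algebraic span of the number states `|0⟩, |1⟩, |2⟩, …`: finite linear combinations, with
`|n⟩ = Finsupp.single n 1`. -/
abbrev FiniteStates : Type := ℕ →₀ ℂ

/-- The operator `z` on finite states: `z |n⟩ = √n |n-1⟩` (so `z |0⟩ = 0`). -/
def lower : Module.End ℂ FiniteStates :=
  Finsupp.linearCombination ℂ fun n : ℕ => Finsupp.single (n - 1) ((Real.sqrt n : ℝ) : ℂ)

/-- The operator `z*` on finite states: `z* |n⟩ = √(n+1) |n+1⟩`. -/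
def raise : Module.End ℂ FiniteStates :=
  Finsupp.linearCombination ℂ fun n : ℕ =>
    Finsupp.single (n + 1) ((Real.sqrt (n + 1 : ℝ) : ℝ) : ℂ)

/-- `f(ζ)` for `ζ = z* z`: as `ζ |n⟩ = n |n⟩`, this is the operator `f(ζ) |n⟩ = f(n) |n⟩`. -/
def funcOfNumber (f : ℕ → ℂ) : Module.End ℂ FiniteStates :=
  Finsupp.linearCombination ℂ fun n : ℕ => Finsupp.single n (f n)

theorem lower_single (n : ℕ) (c : ℂ) :
    lower (Finsupp.single n c) = Finsupp.single (n - 1) (c * ((Real.sqrt n : ℝ) : ℂ)) := by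
  simp [lower]

theorem raise_single (n : ℕ) (c : ℂ) :
    raise (Finsupp.single n c) =
      Finsupp.single (n + 1) (c * ((Real.sqrt (n + 1 : ℝ) : ℝ) : ℂ)) := by
  simp [raise]

theorem funcOfNumber_single (f : ℕ → ℂ) (n : ℕ) (c : ℂ) :
    funcOfNumber f (Finsupp.single n c) = Finsupp.single n (c * f n) := by
  simp [funcOfNumber]

/-- `ζ = z* z` has `ζ |n⟩ = n |n⟩`. -/
theorem raise_mul_lower : raise * lower = funcOfNumber fun n => (n : ℂ) := by
  apply Finsupp.lhom_ext
  intro n c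
  rw [Module.End.mul_apply, lower_single, raise_single, funcOfNumber_single]
  rcases n with _ | n
  · simp
  · have h : ((Real.sqrt (n + 1 : ℝ) : ℝ) : ℂ) * ((Real.sqrt (n + 1 : ℝ) : ℝ) : ℂ)
        = (n : ℂ) + 1 := by
      rw [← Complex.ofReal_mul, Real.mul_self_sqrt (by positivity)]
      push_cast
      ring
    simp [mul_assoc, h]

/-- The canonical commutation relation `[z, z*] = 1`. -/
theorem lower_raise_commutator : lower * raise - raise * lower = 1 := by
  rw [raise_mul_lower]
  apply Finsupp.lhom_ext
  intro n c
  have h : ((Real.sqrt (n + 1 : ℝ) : ℝ) : ℂ) * ((Real.sqrt (n + 1 : ℝ) : ℝ) : ℂ)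
      = (n : ℂ) + 1 := by
    rw [← Complex.ofReal_mul, Real.mul_self_sqrt (by positivity)]
    push_cast
    ring
  rw [LinearMap.sub_apply, Module.End.mul_apply, raise_single, lower_single, funcOfNumber_single,
    Module.End.one_apply]
  simp only [Nat.add_sub_cancel, Nat.cast_add, Nat.cast_one, mul_assoc, h]
  rw [← Finsupp.single_sub]
  congr 1
  ring

/-- The Kummer function `Φ(a, b; x) = ∑ⱼ (a)ⱼ / (b)ⱼ · xʲ / j!`. -/
def kummer (a b x : ℂ) : ℂ :=
  ∑' j : ℕ, (ascPochhammer ℂ j).eval a / (ascPochhammer ℂ j).eval b * x ^ j / (j.factorial : ℂ)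

/-- The radial function
`f_k^λ(m) = (-λ²)^{k/2} / (2^k k!) · exp(-λ²/8) · Φ(-m, 1 + k; λ²/4)` (principal power). -/
def radial (k : ℕ) (l : ℝ) (m : ℕ) : ℂ :=
  (-(l : ℂ) ^ 2) ^ ((k : ℂ) / 2) / (2 ^ k * (k.factorial : ℂ)) * Complex.exp (-(l : ℂ) ^ 2 / 8) *
    kummer (-(m : ℂ)) (1 + (k : ℂ)) ((l : ℂ) ^ 2 / 4)

/-- The basis element `D_k^λ`: it is `z*^k f_k^λ(ζ)` for `k ≥ 0` and `f_{-k}^λ(ζ) z^{-k}` for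
`k ≤ 0`. -/
def D (k : ℤ) (l : ℝ) : Module.End ℂ FiniteStates :=
  if 0 ≤ k then raise ^ k.toNat * funcOfNumber (radial k.toNat l)
  else funcOfNumber (radial (-k).toNat l) * lower ^ (-k).toNat

section HilbertSpace

variable {X : Type*} [NormedAddCommGroup X] [InnerProductSpace ℂ X]

/-- Finite states as vectors of the Hilbert space `X` with complete orthonormal basis
`e n = |n⟩`. -/
def toX (e : HilbertBasis ℕ ℂ X) : FiniteStates →ₗ[ℂ] X :=
  Finsupp.linearCombination ℂ fun n => e n

/-- The `m`-th term `⟨m| (D_k^l)* D_n^l' |m⟩ = ⟨D_k^l m, D_n^l' m⟩` of the trace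
`(D_k^l, D_n^l') = tr ((D_k^l)* D_n^l')`. -/
def traceTerm (e : HilbertBasis ℕ ℂ X) (k n : ℤ) (l l' : ℝ) (m : ℕ) : ℂ :=
  ⟪toX e (D k l (Finsupp.single m 1)), toX e (D n l' (Finsupp.single m 1))⟫_ℂ

/-- Smooth compactly supported complex test functions on the open half-line `(0, ∞)`, the range of
the variable `s = λ²`. -/
def IsTestFn (φ : ℝ → ℂ) : Prop :=
  ContDiff ℝ ∞ φ ∧ HasCompactSupport φ ∧ tsupport φ ⊆ Ioi 0

/-- The bounded operator `A` on `X` is the smeared basis element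
`D_k[φ] = ∫ φ(λ²) D_k^λ d(λ²)`, the integral being taken on finite states. -/
def IsSmeared (e : HilbertBasis ℕ ℂ X) (k : ℤ) (φ : ℝ → ℂ) (A : X →L[ℂ] X) : Prop :=
  ∀ v : FiniteStates,
    IntegrableOn (fun s : ℝ => φ s • toX e (D k (Real.sqrt s) v)) (Ioi 0) ∧
      A (toX e v) = ∫ s in Ioi (0 : ℝ), φ s • toX e (D k (Real.sqrt s) v)

/-- Membership in the Hilbert space `K`: `tr (A* A) = ∑ ‖A |m⟩‖² < ∞`. -/
def MemK (e : HilbertBasis ℕ ℂ X) (A : X →L[ℂ] X) : Prop :=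
  Summable fun m : ℕ => ‖A (e m)‖ ^ 2

/-- `(A, B) = tr (A* B)` converges and equals `c`. -/
def HasTraceInner [CompleteSpace X] (e : HilbertBasis ℕ ℂ X) (A B : X →L[ℂ] X) (c : ℂ) : Prop :=
  HasSum (fun m : ℕ => ⟪e m, (ContinuousLinearMap.adjoint A ∘L B) (e m)⟫_ℂ) c

end HilbertSpace

end Heisenberg

end

noncomputable section

namespace Heisenberg

/-! ### Laguerre polynomials -/

/-! With x = λ²/4, the operator `D k λ` sends |m⟩ to i^|k| ℓ(x) |m+k⟩, where ℓ is the normalized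
Laguerre function of order |k| and index min(m, m+k) (`D_single`). For k ≠ n the trace terms
therefore vanish one by one. For k = n the trace is the kernel Σ ℓ_m(x) ℓ_m(x'), which should be δ(x
- x'); the factor 4 is the Jacobian of s = 4x. Everything reduces to the Laguerre expansion of a
test function, pointwise on [0, ∞) (`hasSum_lagFun_mul_lagFunCoeff`), and to its Parseval identity,
which follows by integrating the expansion against a second test function. Neither orthogonality of
the Laguerre functions nor L² theory enters.

The expansion rests on two facts. First, the coefficients decay rapidly: Cauchy's estimate on the
generating function bounds L_m polynomially in m, and Laguerre's equation, moved onto the test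
function by parts, gains any power of m + 1 (`exists_lagCoeff_bound`). Hence the series, suitably
weighted, converges uniformly to a continuous function.

Second, this sum has the right Fourier transform. The transform of the m-th weighted polynomial at
frequency ξ is a constant times (1 - 1/w)^m with w = 1 + iξ. Summing over m gives the generating
function of the coefficients at t = 1 - 1/w, where the kernel exp(-x t/(1 - t)) is exactly exp(-iξx)
(`integral_exp_mul_lagSeries`). Fourier inversion then identifies the sum with the test function
(`lagSeries_eq`).

Rapid decay also makes the matrix entries of the smeared element absolutely summable, so the bounded
operator is a norm-convergent sum of rank-one operators. -/

/-- The associated Laguerre polynomial `L_m^{(k)}`. -/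
def lagPoly (k m : ℕ) : Polynomial ℝ :=
  ∑ j ∈ Finset.range (m + 1),
    Polynomial.monomial j ((-1) ^ j * ((m + k).choose (k + j) : ℝ) / (j.factorial : ℝ))

theorem lagPoly_coeff (k m j : ℕ) :
    (lagPoly k m).coeff j = (-1) ^ j * ((m + k).choose (k + j) : ℝ) / (j.factorial : ℝ) := by
  simp only [lagPoly, Polynomial.finsetSum_coeff, Polynomial.coeff_monomial,
    Finset.sum_ite_eq', Finset.mem_range]
  split_ifs with h
  · rfl
  · rw [Nat.choose_eq_zero_of_lt (by omega)]
    simp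

theorem lagPoly_eval (k m : ℕ) (x : ℝ) :
    (lagPoly k m).eval x = ∑ j ∈ Finset.range (m + 1),
      ((m + k).choose (k + j) : ℝ) * ((-x) ^ j / (j.factorial : ℝ)) := by
  simp only [lagPoly, Polynomial.eval_finsetSum, Polynomial.eval_monomial]
  refine Finset.sum_congr rfl fun j _ => ?_
  rw [neg_pow x]
  ring

open Polynomial in
/-- Laguerre's differential equation. -/
theorem lagPoly_ode (k m : ℕ) :
    X * derivative (derivative (lagPoly k m))
      + (C ((k : ℝ) + 1) - X) * derivative (lagPoly k m) + C (m : ℝ) * lagPoly k m = 0 := by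
  -- Read coefficientwise, Laguerre's equation is this two-term recursion, which comes from C(n,
  -- r+1)(r+1) = C(n, r)(n - r).
  have key : ∀ j : ℕ, (lagPoly k m).coeff (j + 1) * ((j + 1) * (k + 1 + j))
      = ((j : ℝ) - m) * (lagPoly k m).coeff j := by
    intro j
    simp only [lagPoly_coeff]
    have h : (((m + k).choose (k + j + 1) : ℕ) : ℝ) * (k + j + 1)
        = ((m + k).choose (k + j) : ℝ) * ((m : ℝ) - j) := by
      have h0 := Nat.choose_succ_right_eq (m + k) (k + j)
      rcases le_or_gt j m with hj | hj
      · rw [show m + k - (k + j) = m - j by omega] at h0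
        rw [← Nat.cast_sub hj]
        exact_mod_cast h0
      · rw [Nat.choose_eq_zero_of_lt (by omega), Nat.choose_eq_zero_of_lt (by omega)]
        simp
    rw [← add_assoc, Nat.factorial_succ, pow_succ]
    push_cast
    have hj : (j.factorial : ℝ) ≠ 0 := by positivity
    have hj' : (j : ℝ) + 1 ≠ 0 := by positivity
    field_simp
    linear_combination -h
  ext j
  rcases j with _ | j
  · have := key 0
    simp only [sub_mul, coeff_add, coeff_sub, coeff_X_mul_zero, coeff_C_mul, coeff_derivative,
      coeff_zero]
    push_cast at *
    linear_combination this
  · have := key (j + 1)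
    simp only [sub_mul, coeff_add, coeff_sub, coeff_X_mul, coeff_C_mul, coeff_derivative,
      coeff_zero]
    push_cast at *
    linear_combination this

/-- The Pochhammer symbol (-m)_j vanishes for j > m, so the Kummer series terminates; the remaining
factorials assemble into binomial coefficients. -/
theorem kummer_eq_lagPoly (k m : ℕ) (x : ℝ) :
    kummer (-(m : ℂ)) (1 + (k : ℂ)) (x : ℂ) =
      (m.factorial : ℂ) * k.factorial / (m + k).factorial * (((lagPoly k m).eval x : ℝ) : ℂ) := by
  have hasc : ∀ j : ℕ, (ascPochhammer ℂ j).eval (1 + (k : ℂ))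
      = ((k + j).factorial : ℂ) / k.factorial := by
    intro j
    have h1 : (1 + (k : ℂ)) = ((k + 1 : ℕ) : ℂ) := by push_cast; ring
    rw [h1, ← ascPochhammer_eval_cast, ascPochhammer_nat_eq_ascFactorial,
      eq_div_iff (Nat.cast_ne_zero.2 k.factorial_ne_zero), mul_comm]
    exact_mod_cast Nat.factorial_mul_ascFactorial k j
  have hdesc : ∀ j : ℕ, (ascPochhammer ℂ j).eval (-(m : ℂ))
      = (-1) ^ j * (m.descFactorial j : ℂ) := by
    intro j
    rw [ascPochhammer_eval_neg_eq_descPochhammer, descPochhammer_eval_eq_descFactorial]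
  rw [kummer, tsum_eq_sum (s := Finset.range (m + 1)), lagPoly_eval]
  · push_cast
    rw [Finset.mul_sum]
    refine Finset.sum_congr rfl fun j hj => ?_
    have hjm : j ≤ m := by simpa [Nat.lt_succ_iff] using hj
    rw [hasc, hdesc]
    have h1 : ((m - j).factorial : ℂ) * m.descFactorial j = m.factorial := by
      exact_mod_cast Nat.factorial_mul_descFactorial hjm
    have h2 : ((m + k).choose (k + j) : ℂ) * (k + j).factorial * (m - j).factorial
        = (m + k).factorial := by
      have := Nat.choose_mul_factorial_mul_factorial (show k + j ≤ m + k by omega)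
      rw [show m + k - (k + j) = m - j by omega] at this
      exact_mod_cast this
    have h3 : ((m - j).factorial : ℂ) ≠ 0 := Nat.cast_ne_zero.2 (Nat.factorial_ne_zero _)
    have h4 : ((k + j).factorial : ℂ) ≠ 0 := Nat.cast_ne_zero.2 (Nat.factorial_ne_zero _)
    have h5 : ((m + k).factorial : ℂ) ≠ 0 := Nat.cast_ne_zero.2 (Nat.factorial_ne_zero _)
    have h6 : (k.factorial : ℂ) ≠ 0 := Nat.cast_ne_zero.2 (Nat.factorial_ne_zero _)
    have h7 : (j.factorial : ℂ) ≠ 0 := Nat.cast_ne_zero.2 (Nat.factorial_ne_zero _)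
    rw [neg_pow (x : ℂ)]
    field_simp
    rw [← h1, ← h2]
    ring
  · intro j hj
    have hjm : m < j := by simpa [Nat.lt_succ_iff] using hj
    rw [hdesc, Nat.descFactorial_of_lt hjm]
    simp

/-- The orthonormal Laguerre functions on `[0, ∞)`. -/
def lagFun (k m : ℕ) (x : ℝ) : ℝ :=
  Real.sqrt (m.factorial / (m + k).factorial) * (Real.sqrt x ^ k * Real.exp (-x / 2)) *
    (lagPoly k m).eval x

theorem continuous_lagFun (k m : ℕ) : Continuous (lagFun k m) := by
  unfold lagFun
  fun_prop

/-! ### Matrix elements of the basis elements -/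

/-- Since -λ² = (|λ| i)² and |λ| i has argument 0 or π/2, its principal square root is |λ| i; π/2 is
the closed end of the admissible interval. -/
theorem neg_sq_cpow (k : ℕ) (l : ℝ) :
    (-(l : ℂ) ^ 2) ^ ((k : ℂ) / 2) = Complex.I ^ k * ((|l| : ℝ) : ℂ) ^ k := by
  have h1 : (-(l : ℂ) ^ 2) = (((|l| : ℝ) : ℂ) * Complex.I) ^ 2 := by
    rw [mul_pow, Complex.I_sq, ← Complex.ofReal_pow, ← Complex.ofReal_pow, sq_abs]
    ring
  have harg : (((|l| : ℝ) : ℂ) * Complex.I).arg = 0 ∨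
      (((|l| : ℝ) : ℂ) * Complex.I).arg = Real.pi / 2 := by
    rcases eq_or_ne l 0 with rfl | hl
    · simp
    · right
      rw [Complex.arg_real_mul _ (abs_pos.2 hl), Complex.arg_I]
  have h2 : (k : ℂ) / 2 = ((2 : ℕ) : ℂ)⁻¹ * k := by
    push_cast
    ring
  rw [h2, Complex.cpow_mul_nat, h1, Complex.pow_cpow_nat_inv two_ne_zero, mul_pow, mul_comm]
  · rcases harg with h | h <;> rw [h] <;> push_cast <;> linarith [Real.pi_pos]
  · rcases harg with h | h <;> rw [h] <;> push_cast <;> linarith [Real.pi_pos]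

theorem sqrt_sq_div_four (l : ℝ) : Real.sqrt (l ^ 2 / 4) = |l| / 2 := by
  rw [show l ^ 2 / 4 = (l / 2) ^ 2 by ring, Real.sqrt_sq_eq_abs, abs_div]
  norm_num

/-- The square root is the factor produced by the k-th power of `raise` or `lower`. It turns the
Kummer normalization m! k!/(m+k)! into that of the Laguerre functions, while |λ|^k / 2^k becomes
√x^k at x = λ²/4. -/
theorem radial_mul_sqrt (k m : ℕ) (l : ℝ) :
    radial k l m * ((Real.sqrt ((m + k).factorial / m.factorial) : ℝ) : ℂ) =
      Complex.I ^ k * ((lagFun k m (l ^ 2 / 4) : ℝ) : ℂ) := by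
  have hx : (l : ℂ) ^ 2 / 4 = ((l ^ 2 / 4 : ℝ) : ℂ) := by push_cast; ring
  have he : Complex.exp (-(l : ℂ) ^ 2 / 8) = ((Real.exp (-(l ^ 2 / 4) / 2) : ℝ) : ℂ) := by
    push_cast
    congr 1
    ring
  have hs : Real.sqrt (m.factorial / (m + k).factorial)
      = m.factorial / (m + k).factorial * Real.sqrt ((m + k).factorial / m.factorial) := by
    rw [Real.sqrt_div (by positivity), Real.sqrt_div (by positivity)]
    have h1 := Real.mul_self_sqrt (Nat.cast_nonneg (α := ℝ) m.factorial)
    have h2 := Real.mul_self_sqrt (Nat.cast_nonneg (α := ℝ) (m + k).factorial)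
    have h3 : Real.sqrt (m.factorial : ℝ) ≠ 0 := by positivity
    have h4 : Real.sqrt ((m + k).factorial : ℝ) ≠ 0 := by positivity
    field_simp
    rw [sq, sq, h1, h2, mul_comm]
  rw [radial, neg_sq_cpow, hx, kummer_eq_lagPoly, he, lagFun, hs, sqrt_sq_div_four]
  have h6 : (k.factorial : ℂ) ≠ 0 := Nat.cast_ne_zero.2 (Nat.factorial_ne_zero _)
  push_cast
  rw [div_pow]
  field_simp

theorem raise_pow_single (j n : ℕ) (c : ℂ) :
    (raise ^ j) (Finsupp.single n c) = Finsupp.single (n + j)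
      (c * ((Real.sqrt ((n + j).factorial / n.factorial) : ℝ) : ℂ)) := by
  induction j with
  | zero =>
    have : (n.factorial : ℝ) ≠ 0 := by positivity
    simp [this]
  | succ j ih =>
    rw [pow_succ', Module.End.mul_apply, ih, raise_single, ← add_assoc, mul_assoc,
      ← Complex.ofReal_mul, ← Real.sqrt_mul (by positivity), Nat.factorial_succ]
    congr 4
    push_cast
    ring

theorem lower_pow_single (j n : ℕ) (c : ℂ) :
    (lower ^ j) (Finsupp.single (n + j) c) = Finsupp.single n
      (c * ((Real.sqrt ((n + j).factorial / n.factorial) : ℝ) : ℂ)) := by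
  induction j generalizing c with
  | zero =>
    have : (n.factorial : ℝ) ≠ 0 := by positivity
    simp [this]
  | succ j ih =>
    rw [pow_succ, Module.End.mul_apply, ← add_assoc, lower_single, Nat.add_sub_cancel, ih,
      mul_assoc, ← Complex.ofReal_mul, ← Real.sqrt_mul (by positivity), Nat.factorial_succ]
    congr 4
    push_cast
    ring

theorem lower_pow_single_of_lt {j n : ℕ} (h : n < j) (c : ℂ) :
    (lower ^ j) (Finsupp.single n c) = 0 := by
  obtain ⟨i, rfl⟩ : ∃ i, j = i + 1 + n := ⟨j - n - 1, by omega⟩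
  have := lower_pow_single n 0 c
  rw [zero_add] at this
  rw [pow_add, Module.End.mul_apply, this, pow_succ, Module.End.mul_apply, lower_single]
  simp

/-- The matrix element `⟨m + k| D_k^λ |m⟩` as a function of `x = λ² / 4`, up to the phase. -/
def entry (k : ℤ) (m : ℕ) (x : ℝ) : ℝ :=
  if 0 ≤ (m : ℤ) + k then lagFun k.natAbs (min m ((m : ℤ) + k).toNat) x else 0

/-- Raising after and lowering before the radial function both evaluate it at min(m, m+k), so one
formula covers both signs of k. When m + k < 0 the index truncates to 0, harmlessly, because the
entry is then zero. -/
theorem D_single (k : ℤ) (l : ℝ) (m : ℕ) :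
    D k l (Finsupp.single m 1) = Finsupp.single ((m : ℤ) + k).toNat
      (Complex.I ^ k.natAbs * ((entry k m (l ^ 2 / 4) : ℝ) : ℂ)) := by
  rcases le_or_gt 0 k with hk | hk
  · obtain ⟨j, rfl⟩ := Int.eq_ofNat_of_zero_le hk
    have h1 : ((m : ℤ) + (j : ℤ)).toNat = m + j := by omega
    rw [D, if_pos hk, entry, if_pos (by omega), Module.End.mul_apply, funcOfNumber_single,
      Int.toNat_natCast, raise_pow_single, h1, one_mul, radial_mul_sqrt, Int.natAbs_natCast,
      min_eq_left (by omega)]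
  · obtain ⟨j, rfl⟩ : ∃ j : ℕ, k = -j := ⟨k.natAbs, by omega⟩
    rw [D, if_neg (by omega), Module.End.mul_apply, neg_neg, Int.toNat_natCast, Int.natAbs_neg,
      Int.natAbs_natCast]
    rcases lt_or_ge m j with h | h
    · rw [lower_pow_single_of_lt h, entry, if_neg (by omega)]
      simp
    · obtain ⟨i, rfl⟩ := Nat.exists_eq_add_of_le' h
      have h1 : (((i + j : ℕ) : ℤ) + -(j : ℤ)).toNat = i := by omega
      rw [lower_pow_single, funcOfNumber_single, one_mul, mul_comm, radial_mul_sqrt, entry,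
        if_pos (by omega), h1, min_eq_right (by omega), Int.natAbs_neg, Int.natAbs_natCast]

theorem continuous_entry (k : ℤ) (m : ℕ) : Continuous (entry k m) := by
  unfold entry
  split_ifs
  · exact continuous_lagFun _ _
  · exact continuous_const

/-- Sums over the diagonal `m ↦ m + k` of `ℕ × ℕ`. -/
theorem hasSum_diagonal {E : Type*} [AddCommMonoid E] [TopologicalSpace E] {f : ℕ → E} {a : E}
    (k : ℤ) (h : HasSum f a) :
    HasSum (fun m : ℕ => if 0 ≤ (m : ℤ) + k then f (min m ((m : ℤ) + k).toNat) else 0) a := by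
  have hinj : Function.Injective (fun i : ℕ => i + (-k).toNat) := fun a b h => by
    simpa using h
  rw [← hinj.hasSum_iff]
  · convert h using 1
    funext i
    have h1 : 0 ≤ (((i + (-k).toNat : ℕ) : ℤ) + k) := by omega
    have h2 : min (i + (-k).toNat) (((i + (-k).toNat : ℕ) : ℤ) + k).toNat = i := by omega
    simp only [Function.comp, if_pos h1, h2]
  · intro m hm
    refine if_neg fun h0 => hm ⟨m - (-k).toNat, ?_⟩
    simp only
    omega

/-! ### The generating function -/

theorem one_sub_ne_zero_of_norm_lt_one {t : ℂ} (ht : ‖t‖ < 1) : 1 - t ≠ 0 := by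
  intro h
  rw [← sub_eq_zero.1 h] at ht
  simp at ht

/-- This is the negative binomial series of order k + j shifted by j places; the terms with m < j
vanish. -/
theorem hasSum_choose_add_mul_pow {𝕜 : Type*} [NormedField 𝕜] [CompleteSpace 𝕜] (k j : ℕ) {t : 𝕜}
    (ht : ‖t‖ < 1) :
    HasSum (fun m : ℕ => ((m + k).choose (k + j) : 𝕜) * t ^ m)
      ((1 / (1 - t) ^ (k + 1)) * (t / (1 - t)) ^ j) := by
  have h := (hasSum_choose_mul_geometric_of_norm_lt_one (k + j) ht).mul_left (t ^ j)
  have hinj : Function.Injective (fun i : ℕ => i + j) := fun a b h => by simpa using h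
  rw [← hinj.hasSum_iff]
  · have h1 : (1 / (1 - t) ^ (k + 1)) * (t / (1 - t)) ^ j
        = t ^ j * (1 / (1 - t) ^ (k + j + 1)) := by
      rw [show k + j + 1 = (k + 1) + j by omega, pow_add _ (k + 1), div_pow, div_mul_div_comm, one_mul,
        mul_one_div]
    rw [h1]
    refine h.congr_fun fun i => ?_
    simp only [Function.comp, pow_add]
    rw [show i + j + k = i + (k + j) by omega]
    ring
  · intro m hm
    have hmj : m < j := by
      by_contra hc
      exact hm ⟨m - j, by simp only; omega⟩
    rw [Nat.choose_eq_zero_of_lt (by omega)]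
    simp

/-- Expand L_m and exchange the two sums: summing over m first gives negative binomial series, and
then the sum over j is an exponential. Replacing x and t by their absolute values gives the
convergent majorant that permits the exchange. -/
theorem hasSum_lagPoly_mul_pow (k : ℕ) (x : ℝ) {t : ℂ} (ht : ‖t‖ < 1) :
    HasSum (fun m : ℕ => (((lagPoly k m).eval x : ℝ) : ℂ) * t ^ m)
      ((1 / (1 - t) ^ (k + 1)) * Complex.exp (-x * (t / (1 - t)))) := by
  have hexp : ∀ z w : ℂ, HasSum (fun j : ℕ => z ^ j / (j.factorial : ℂ) * w ^ j)
      (Complex.exp (z * w)) := by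
    intro z w
    have h := NormedSpace.expSeries_div_hasSum_exp (𝔸 := ℂ) (z * w)
    rw [← Complex.exp_eq_exp_ℂ] at h
    refine h.congr_fun fun j => ?_
    rw [mul_pow]
    ring
  obtain ⟨f, hf⟩ : ∃ f : ℕ × ℕ → ℂ, ∀ j m, f (j, m) =
      ((-x : ℂ) ^ j / (j.factorial : ℂ)) * (((m + k).choose (k + j) : ℂ) * t ^ m) :=
    ⟨fun p => ((-x : ℂ) ^ p.1 / (p.1.factorial : ℂ)) *
      (((p.2 + k).choose (k + p.1) : ℂ) * t ^ p.2), fun j m => rfl⟩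
  have hrow : ∀ j, HasSum (fun m => f (j, m)) (((-x : ℂ) ^ j / (j.factorial : ℂ)) *
      ((1 / (1 - t) ^ (k + 1)) * (t / (1 - t)) ^ j)) := fun j => by
    simp only [hf]
    exact (hasSum_choose_add_mul_pow k j ht).mul_left _
  have hsum : Summable f := by
    rw [← summable_norm_iff, summable_prod_of_nonneg fun p => norm_nonneg _]
    have ht' : ‖(‖t‖ : ℝ)‖ < 1 := by simpa using ht
    have hr : ∀ j, HasSum (fun m => ‖f (j, m)‖) ((|x| ^ j / (j.factorial : ℝ)) *
        ((1 / (1 - ‖t‖) ^ (k + 1)) * (‖t‖ / (1 - ‖t‖)) ^ j)) := by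
      intro j
      refine ((hasSum_choose_add_mul_pow k j ht').mul_left (|x| ^ j / (j.factorial : ℝ))).congr_fun
        fun m => ?_
      simp [hf]
    refine ⟨fun j => (hr j).summable, ?_⟩
    simp only [fun j => (hr j).tsum_eq]
    have h := (Real.summable_pow_div_factorial (|x| * (‖t‖ / (1 - ‖t‖)))).mul_left
      (1 / (1 - ‖t‖) ^ (k + 1))
    refine h.congr fun j => ?_
    rw [mul_pow]
    ring
  have htot : HasSum f ((1 / (1 - t) ^ (k + 1)) * Complex.exp (-x * (t / (1 - t)))) := by
    have h1 := hsum.hasSum.prod_fiberwise hrow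
    have h2 := (hexp (-x) (t / (1 - t))).mul_left (1 / (1 - t) ^ (k + 1))
    have h3 := h1.unique (h2.congr_fun fun j => by ring)
    rw [← h3]
    exact hsum.hasSum
  -- In the other order, each fixed m leaves only the finite sum over j ≤ m, which is L_m(x) t^m.
  refine ((Equiv.prodComm ℕ ℕ).hasSum_iff.2 htot).prod_fiberwise fun m => ?_
  have h4 : ∑ j ∈ Finset.range (m + 1), f (j, m) = (((lagPoly k m).eval x : ℝ) : ℂ) * t ^ m := by
    rw [lagPoly_eval]
    push_cast
    rw [Finset.sum_mul]
    refine Finset.sum_congr rfl fun j _ => ?_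
    simp only [hf]
    ring
  rw [← h4]
  refine hasSum_sum_of_ne_finset_zero fun j hj => ?_
  have hjm : m < j := by simpa [Nat.lt_succ_iff] using hj
  change f (j, m) = 0
  rw [hf, Nat.choose_eq_zero_of_lt (by omega)]
  simp

/-! ### Growth of the Laguerre polynomials -/

/-- Cauchy's estimate for the coefficients of a power series. -/
theorem norm_coeff_mul_pow_le {a : ℕ → ℂ} {F : ℂ → ℂ}
    (hF : ∀ t : ℂ, ‖t‖ < 1 → HasSum (fun m => a m * t ^ m) (F t))
    (hd : DifferentiableOn ℂ F (Metric.ball 0 1)) {r M : ℝ} (hr0 : 0 < r) (hr1 : r < 1)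
    (hM : ∀ t : ℂ, ‖t‖ = r → ‖F t‖ ≤ M) (m : ℕ) : ‖a m‖ * r ^ m ≤ M := by
  -- Radius 1/2 is enough here: the expansion only identifies the a n with the Taylor coefficients
  -- at 0. The estimate on the circle of radius r uses differentiability on the whole unit disc.
  have hps : HasFPowerSeriesOnBall F (FormalMultilinearSeries.ofScalars ℂ a) 0
      ((1 / 2 : NNReal) : ENNReal) := by
    refine ⟨?_, by simp, ?_⟩
    · refine FormalMultilinearSeries.le_radius_of_summable_norm _ ?_
      have h := (hF (1 / 2) (by norm_num)).summable.norm
      refine h.congr fun n => ?_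
      rw [FormalMultilinearSeries.ofScalars_norm]
      simp
    · intro y hy
      have hy' : ‖y‖ < 1 := by
        rw [Metric.eball_coe, mem_ball_zero_iff] at hy
        refine hy.trans ?_
        norm_num
      simpa [FormalMultilinearSeries.ofScalars_apply_eq, mul_comm] using hF y hy'
  have hcoeff : ∀ n, a n = iteratedDeriv n F 0 / n.factorial := by
    have h := hps.hasFPowerSeriesAt.eq_formalMultilinearSeries
      hps.hasFPowerSeriesAt.analyticAt.hasFPowerSeriesAt
    exact congrFun (FormalMultilinearSeries.ofScalars_series_injective ℂ ℂ h)
  have hc := Complex.norm_iteratedDeriv_le_of_forall_mem_sphere_norm_le m hr0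
    (hd.diffContOnCl_ball (Metric.closedBall_subset_ball hr1))
    (fun z hz => hM z (by simpa using hz))
  have hfac : (0 : ℝ) < m.factorial := by positivity
  have hrm : 0 < r ^ m := by positivity
  rw [hcoeff, norm_div, Complex.norm_natCast]
  rw [le_div_iff₀ hrm] at hc
  rw [div_mul_eq_mul_div, div_le_iff₀ hfac]
  linarith

/-- The Möbius map t ↦ t/(1 - t) carries the unit disc into the half-plane Re > -1/2. This bounds
the exponential in the generating function by exp(x/2), uniformly in t. -/
theorem re_neg_div_one_sub_le {t : ℂ} (ht : ‖t‖ < 1) : -(t / (1 - t)).re ≤ 1 / 2 := by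
  have h1 : 1 - t ≠ 0 := one_sub_ne_zero_of_norm_lt_one ht
  have h2 : 0 < Complex.normSq (1 - t) := Complex.normSq_pos.2 h1
  have h3 : Complex.normSq t < 1 := by
    rw [Complex.normSq_eq_norm_sq]
    nlinarith [norm_nonneg t]
  rw [Complex.div_re, ← add_div, ← neg_div, div_le_iff₀ h2]
  simp only [Complex.normSq_apply, Complex.sub_re, Complex.sub_im, Complex.one_re,
    Complex.one_im] at *
  nlinarith

theorem abs_lagPoly_mul_pow_le (k m : ℕ) {x r : ℝ} (hx : 0 ≤ x) (hr0 : 0 < r) (hr1 : r < 1) :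
    |(lagPoly k m).eval x| * r ^ m ≤ 1 / (1 - r) ^ (k + 1) * Real.exp (x / 2) := by
  have h := norm_coeff_mul_pow_le (a := fun m => (((lagPoly k m).eval x : ℝ) : ℂ))
    (F := fun t => (1 / (1 - t) ^ (k + 1)) * Complex.exp (-x * (t / (1 - t))))
    (fun t ht => hasSum_lagPoly_mul_pow k x ht) ?_ hr0 hr1 (M := 1 / (1 - r) ^ (k + 1) *
      Real.exp (x / 2)) ?_ m
  · simpa using h
  · intro t ht
    have h1 : 1 - t ≠ 0 := one_sub_ne_zero_of_norm_lt_one (by simpa using ht)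
    refine DifferentiableAt.differentiableWithinAt ?_
    have h2 : (1 - t) ^ (k + 1) ≠ 0 := pow_ne_zero _ h1
    fun_prop (disch := assumption)
  · intro t ht
    have h1 : 1 - r ≤ ‖1 - t‖ := by
      have := norm_sub_norm_le 1 t
      rw [norm_one, ht] at this
      exact this
    rw [norm_mul, norm_div, norm_one, norm_pow, Complex.norm_exp]
    have h2 : 0 < 1 - r := by linarith
    gcongr
    have h3 := re_neg_div_one_sub_le (ht.trans_lt hr1)
    have h4 : (-(x : ℂ) * (t / (1 - t))).re = x * -(t / (1 - t)).re := by
      rw [← Complex.ofReal_neg, Complex.re_ofReal_mul]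
      ring
    rw [h4]
    nlinarith

/-- Cauchy's estimate on a radius tending to 1 with m: for r = (m+1)/(m+2) the pole costs only
(m+2)^(k+1), while r^m stays above 1/3. -/
theorem abs_lagPoly_le (k m : ℕ) {x : ℝ} (hx : 0 ≤ x) :
    |(lagPoly k m).eval x| ≤ 3 * 2 ^ (k + 1) * ((m : ℝ) + 1) ^ (k + 1) * Real.exp (x / 2) := by
  have hm : (0 : ℝ) ≤ m := Nat.cast_nonneg m
  set r : ℝ := (m + 1) / (m + 2) with hr
  have hr0 : 0 < r := by positivity
  have hr1 : 1 - r = 1 / (m + 2) := by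
    rw [hr]
    field_simp
    ring
  have hr2 : r < 1 := by
    have : 0 < 1 - r := by rw [hr1]; positivity
    linarith
  have h := abs_lagPoly_mul_pow_le k m hx hr0 hr2
  have hrm : 1 / 3 ≤ r ^ m := by
    -- Here r⁻¹ = 1 + 1/(m+1), so its m-th power is at most e < 3.
    have h1 : (r⁻¹) ^ m ≤ 3 := by
      have h2 : r⁻¹ ≤ Real.exp (1 / (m + 1)) := by
        have := Real.add_one_le_exp (1 / ((m : ℝ) + 1))
        refine le_trans (le_of_eq ?_) this
        rw [hr]
        field_simp
        ring
      calc (r⁻¹) ^ m ≤ Real.exp (1 / (m + 1)) ^ m := by gcongr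
        _ = Real.exp (m * (1 / (m + 1))) := by rw [Real.exp_nat_mul]
        _ ≤ Real.exp 1 := by
          gcongr
          rw [mul_one_div, div_le_one (by positivity)]
          linarith
        _ ≤ 3 := by linarith [Real.exp_one_lt_d9]
    rw [inv_pow] at h1
    have := inv_anti₀ (by positivity) h1
    rw [inv_inv] at this
    linarith
  have h1 : 1 / (1 - r) ^ (k + 1) ≤ 2 ^ (k + 1) * ((m : ℝ) + 1) ^ (k + 1) := by
    rw [hr1, ← mul_pow, div_pow, one_pow, one_div_one_div]
    gcongr
    linarith
  have h2 : |(lagPoly k m).eval x| * (1 / 3) ≤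
      2 ^ (k + 1) * ((m : ℝ) + 1) ^ (k + 1) * Real.exp (x / 2) :=
    (mul_le_mul_of_nonneg_left hrm (abs_nonneg _)).trans
      (h.trans (mul_le_mul_of_nonneg_right h1 (Real.exp_pos _).le))
  linarith

/-! ### Test functions -/

namespace IsTestFn

variable {φ ψ : ℝ → ℂ}

theorem continuous (h : IsTestFn φ) : Continuous φ := h.1.continuous

theorem eq_zero_of_nonpos (h : IsTestFn φ) {x : ℝ} (hx : x ≤ 0) : φ x = 0 :=
  image_eq_zero_of_notMem_tsupport fun hm => (not_lt.2 hx) (h.2.2 hm)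

theorem mul_contDiffOn (h : IsTestFn φ) {g : ℝ → ℂ} (hg : ContDiffOn ℝ ∞ g (Ioi 0)) :
    IsTestFn fun x => φ x * g x := by
  refine ⟨?_, h.2.1.mul_right, (tsupport_mul_subset_left (f := φ) (g := g)).trans h.2.2⟩
  rw [contDiff_iff_contDiffAt]
  intro x
  by_cases hx : x ∈ tsupport φ
  · exact h.1.contDiffAt.mul (hg.contDiffAt (Ioi_mem_nhds (h.2.2 hx)))
  · have h0 : (fun x => φ x * g x) =ᶠ[nhds x] fun _ => 0 := by
      filter_upwards [(isClosed_tsupport φ).isOpen_compl.mem_nhds hx] with y hy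
      rw [image_eq_zero_of_notMem_tsupport hy, zero_mul]
    exact contDiffAt_const.congr_of_eventuallyEq h0

theorem mul_contDiff (h : IsTestFn φ) {g : ℝ → ℂ} (hg : ContDiff ℝ ∞ g) :
    IsTestFn fun x => g x * φ x := by
  simpa only [mul_comm] using h.mul_contDiffOn hg.contDiffOn

theorem deriv (h : IsTestFn φ) : IsTestFn (deriv φ) :=
  ⟨(contDiff_infty_iff_deriv.1 h.1).2, h.2.1.deriv, tsupport_deriv_subset.trans h.2.2⟩

theorem add (h : IsTestFn φ) (h' : IsTestFn ψ) : IsTestFn fun x => φ x + ψ x :=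
  ⟨h.1.add h'.1, h.2.1.add h'.2.1, (tsupport_add φ ψ).trans (union_subset h.2.2 h'.2.2)⟩

theorem neg (h : IsTestFn φ) : IsTestFn fun x => -φ x := by
  simpa using h.mul_contDiff (g := fun _ => -1) contDiff_const

theorem hasDerivAt (h : IsTestFn φ) (x : ℝ) : HasDerivAt φ (_root_.deriv φ x) x :=
  ((contDiff_infty_iff_deriv.1 h.1).1 x).hasDerivAt

theorem integrable_mul (h : IsTestFn φ) {g : ℝ → ℂ} (hg : Continuous g) :
    Integrable fun x => φ x * g x :=
  (h.continuous.mul hg).integrable_of_hasCompactSupport h.2.1.mul_right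

theorem integrable_norm_mul (h : IsTestFn φ) {g : ℝ → ℝ} (hg : Continuous g) :
    Integrable fun x => ‖φ x‖ * g x :=
  (h.continuous.norm.mul hg).integrable_of_hasCompactSupport h.2.1.norm.mul_right

theorem comp_mul_left (h : IsTestFn φ) {c : ℝ} (hc : 0 < c) : IsTestFn fun x => φ (c * x) := by
  refine ⟨h.1.comp (contDiff_const.mul contDiff_id),
    h.2.1.comp_homeomorph (Homeomorph.mulLeft₀ c hc.ne'), ?_⟩
  intro x hx
  have h1 := tsupport_comp_subset_preimage φ (f := fun x : ℝ => c * x) (by fun_prop) hx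
  exact (pos_iff_pos_of_mul_pos (h.2.2 h1)).1 hc

theorem conj (h : IsTestFn φ) : IsTestFn fun x => (starRingEnd ℂ) (φ x) :=
  ⟨Complex.conjCLE.contDiff.comp h.1, h.2.1.comp_left (map_zero _),
    (tsupport_comp_subset (map_zero (starRingEnd ℂ)) φ).trans h.2.2⟩

theorem setIntegral_eq (h : IsTestFn φ) (g : ℝ → ℂ) :
    ∫ x in Ioi (0 : ℝ), φ x * g x = ∫ x, φ x * g x := by
  refine setIntegral_eq_integral_of_forall_compl_eq_zero fun x hx => ?_
  rw [h.eq_zero_of_nonpos (not_lt.1 hx), zero_mul]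

/-- Integration by parts against a polynomial. -/
theorem integral_mul_derivative (h : IsTestFn φ) (P : Polynomial ℝ) :
    ∫ x, φ x * ((P.derivative.eval x : ℝ) : ℂ) = -∫ x, _root_.deriv φ x * ((P.eval x : ℝ) : ℂ) :=
  integral_mul_deriv_eq_deriv_mul_of_integrable (fun x _ => h.hasDerivAt x)
    (fun x _ => (P.hasDerivAt x).ofReal_comp)
    (h.integrable_mul (by fun_prop)) (h.deriv.integrable_mul (by fun_prop))
    (h.integrable_mul (by fun_prop))

end IsTestFn

/-! ### Laguerre coefficients of test functions -/

/-- The pairing of `u` with the Laguerre polynomial `L_m^{(k)}`. -/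
def lagCoeff (k : ℕ) (u : ℝ → ℂ) (m : ℕ) : ℂ :=
  ∫ x, u x * (((lagPoly k m).eval x : ℝ) : ℂ)

/-- The formal adjoint of `1 - x d²/dx² - (k + 1 - x) d/dx`. -/
def lagAdjoint (k : ℕ) (u : ℝ → ℂ) (x : ℝ) : ℂ :=
  u x + -deriv (deriv fun x : ℝ => (x : ℂ) * u x) x
    + deriv (fun x : ℝ => ((k : ℂ) + 1 - x) * u x) x

theorem contDiff_ofReal : ContDiff ℝ ∞ fun x : ℝ => (x : ℂ) := Complex.ofRealCLM.contDiff

theorem IsTestFn.lagAdjoint {u : ℝ → ℂ} (hu : IsTestFn u) (k : ℕ) :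
    IsTestFn (lagAdjoint k u) :=
  (hu.add (hu.mul_contDiff contDiff_ofReal).deriv.deriv.neg).add
    (hu.mul_contDiff (contDiff_const.sub contDiff_ofReal)).deriv

/-- L_m is an eigenfunction of 1 - x d²/dx² - (k+1-x) d/dx with eigenvalue m + 1, and integration by
parts leaves no boundary terms. The added 1 matches the powers of m + 1 in the growth bound. -/
theorem lagCoeff_lagAdjoint {u : ℝ → ℂ} (hu : IsTestFn u) (k m : ℕ) :
    lagCoeff k (lagAdjoint k u) m = ((m : ℂ) + 1) * lagCoeff k u m := by
  have hx := hu.mul_contDiff contDiff_ofReal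
  have hk := hu.mul_contDiff (g := fun x : ℝ => (k : ℂ) + 1 - x) (contDiff_const.sub contDiff_ofReal)
  have i1 := hx.integral_mul_derivative (lagPoly k m).derivative
  have i2 := hx.deriv.integral_mul_derivative (lagPoly k m)
  have i3 := hk.integral_mul_derivative (lagPoly k m)
  have hc : ∀ P : Polynomial ℝ, Continuous fun x : ℝ => ((P.eval x : ℝ) : ℂ) := fun P => by
    fun_prop
  have h1 : lagCoeff k (lagAdjoint k u) m = lagCoeff k u m
      + -(∫ x : ℝ, deriv (deriv fun x : ℝ => (x : ℂ) * u x) x *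
          (((lagPoly k m).eval x : ℝ) : ℂ))
      + ∫ x : ℝ, deriv (fun x : ℝ => ((k : ℂ) + 1 - x) * u x) x *
          (((lagPoly k m).eval x : ℝ) : ℂ) := by
    rw [lagCoeff, lagCoeff, ← integral_neg, ← integral_add, ← integral_add]
    · refine integral_congr_ae (Filter.Eventually.of_forall fun x => ?_)
      simp only [lagAdjoint]
      ring
    · exact (hu.integrable_mul (hc _)).add (hx.deriv.deriv.integrable_mul (hc _)).neg
    · exact hk.deriv.integrable_mul (hc _)
    · exact hu.integrable_mul (hc _)
    · exact (hx.deriv.deriv.integrable_mul (hc _)).neg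
  have h2 : (m : ℂ) * lagCoeff k u m =
      -(∫ x : ℝ, ((x : ℂ) * u x) * (((lagPoly k m).derivative.derivative.eval x : ℝ) : ℂ))
      + -∫ x : ℝ, (((k : ℂ) + 1 - x) * u x) * (((lagPoly k m).derivative.eval x : ℝ) : ℂ) := by
    rw [lagCoeff, ← integral_const_mul, ← integral_neg, ← integral_neg, ← integral_add]
    · refine integral_congr_ae (Filter.Eventually.of_forall fun x => ?_)
      have h := congrArg (fun P : Polynomial ℝ => ((P.eval x : ℝ) : ℂ)) (lagPoly_ode k m)
      simp only [Polynomial.eval_add, Polynomial.eval_mul, Polynomial.eval_sub, Polynomial.eval_X,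
        Polynomial.eval_C, Polynomial.eval_zero] at h
      push_cast at h
      simp only
      linear_combination u x * h
    · exact (hx.integrable_mul (hc _)).neg
    · exact (hk.integrable_mul (hc _)).neg
  rw [h1, add_mul, h2, i1, i2, i3]
  ring

theorem norm_lagCoeff_le {u : ℝ → ℂ} (hu : IsTestFn u) (k m : ℕ) :
    ‖lagCoeff k u m‖ ≤
      (3 * 2 ^ (k + 1) * ∫ x, ‖u x‖ * Real.exp (x / 2)) * ((m : ℝ) + 1) ^ (k + 1) := by
  have hexp : Continuous fun x : ℝ => Real.exp (x / 2) := by fun_prop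
  have h := norm_integral_le_of_norm_le
    ((hu.integrable_norm_mul hexp).const_mul (3 * 2 ^ (k + 1) * ((m : ℝ) + 1) ^ (k + 1)))
    (Filter.Eventually.of_forall fun x => ?_) (f := fun x : ℝ =>
      u x * (((lagPoly k m).eval x : ℝ) : ℂ))
  · rw [integral_const_mul] at h
    rw [lagCoeff]
    linarith
  · rcases le_or_gt x 0 with hx | hx
    · simp [hu.eq_zero_of_nonpos hx]
    · rw [norm_mul, Complex.norm_real, Real.norm_eq_abs]
      have := mul_le_mul_of_nonneg_left (abs_lagPoly_le k m hx.le) (norm_nonneg (u x))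
      linarith

/-- The Laguerre coefficients of a test function decay rapidly. -/
theorem exists_lagCoeff_bound {u : ℝ → ℂ} (hu : IsTestFn u) (k N : ℕ) :
    ∃ C : ℝ, 0 ≤ C ∧ ∀ m : ℕ, ‖lagCoeff k u m‖ * ((m : ℝ) + 1) ^ N ≤ C := by
  have hiter : ∀ (j : ℕ), IsTestFn ((lagAdjoint k)^[j] u) ∧
      ∀ m, lagCoeff k ((lagAdjoint k)^[j] u) m = ((m : ℂ) + 1) ^ j * lagCoeff k u m := by
    intro j
    induction j with
    | zero => simpa using hu
    | succ j ih =>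
      rw [Function.iterate_succ_apply']
      refine ⟨ih.1.lagAdjoint k, fun m => ?_⟩
      rw [lagCoeff_lagAdjoint ih.1, ih.2, pow_succ']
      ring
  -- The polynomial growth bound consumes k + 1 of these powers and leaves N.
  obtain ⟨ht, he⟩ := hiter (N + (k + 1))
  refine ⟨3 * 2 ^ (k + 1) * ∫ x, ‖(lagAdjoint k)^[N + (k + 1)] u x‖ * Real.exp (x / 2),
    by positivity, fun m => ?_⟩
  have h := norm_lagCoeff_le ht k m
  have hn : ‖((m : ℂ) + 1)‖ = (m : ℝ) + 1 := by
    rw [← Nat.cast_succ, Complex.norm_natCast, Nat.cast_succ]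
  rw [he, norm_mul, norm_pow, hn, pow_add] at h
  have hp : 0 < ((m : ℝ) + 1) ^ (k + 1) := by positivity
  refine le_of_mul_le_mul_right ?_ hp
  linarith

theorem summable_one_div_add_one_sq : Summable fun m : ℕ => 1 / ((m : ℝ) + 1) ^ 2 := by
  have h := (summable_nat_add_iff 1).2 (Real.summable_one_div_nat_pow.2 one_lt_two)
  simpa using h

/-- Term-by-term integration under a bound of product form. -/
theorem hasSum_integral_of_norm_le_mul {α : Type*} [MeasurableSpace α] {μ : Measure α}
    {F : ℕ → α → ℂ} {f : α → ℂ} {b : ℕ → ℝ} {g : α → ℝ}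
    (hF : ∀ n, AEStronglyMeasurable (F n) μ) (hb : Summable b) (hg : Integrable g μ)
    (hle : ∀ᵐ x ∂μ, ∀ n, ‖F n x‖ ≤ b n * g x) (hf : ∀ᵐ x ∂μ, HasSum (fun n => F n x) (f x)) :
    HasSum (fun n => ∫ x, F n x ∂μ) (∫ x, f x ∂μ) := by
  refine hasSum_integral_of_dominated_convergence (fun n x => b n * g x) hF
    (fun n => hle.mono fun x hx => hx n) (Filter.Eventually.of_forall fun x => hb.mul_right _) ?_ hf
  simp only [tsum_mul_right]
  exact hg.const_mul _

/-! ### Laplace transforms of the Laguerre polynomials -/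

theorem integrableOn_pow_mul_exp (n : ℕ) {b : ℝ} (hb : 0 < b) :
    IntegrableOn (fun y : ℝ => y ^ n * Real.exp (-b * y)) (Ioi 0) := by
  have h := integrableOn_rpow_mul_exp_neg_mul_rpow (s := n) (p := 1)
    (by linarith [Nat.cast_nonneg (α := ℝ) n]) one_pos hb
  simpa using h

theorem integrableOn_pow_mul_cexp (n : ℕ) {w : ℂ} (hw : 0 < w.re) :
    IntegrableOn (fun y : ℝ => (y : ℂ) ^ n * Complex.exp (-w * y)) (Ioi 0) := by
  refine Integrable.mono' (integrableOn_pow_mul_exp n hw)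
    (Continuous.aestronglyMeasurable (by fun_prop)) ?_
  refine (ae_restrict_iff' measurableSet_Ioi).2 (Filter.Eventually.of_forall fun y hy => ?_)
  rw [norm_mul, norm_pow, Complex.norm_real, Real.norm_of_nonneg (le_of_lt hy), Complex.norm_exp]
  simp

theorem integral_pow_mul_cexp (n : ℕ) {w : ℂ} (hw : 0 < w.re) :
    ∫ y in Ioi (0 : ℝ), (y : ℂ) ^ n * Complex.exp (-w * y) = n.factorial / w ^ (n + 1) := by
  have hw0 : w ≠ 0 := fun h => by simp [h] at hw
  have hexp : ∀ y : ℝ, HasDerivAt (fun y : ℝ => Complex.exp (-w * y))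
      (-w * Complex.exp (-w * y)) y := by
    intro y
    have := ((hasDerivAt_id (y : ℂ)).const_mul (-w)).cexp.comp_ofReal
    simpa [mul_comm] using this
  induction n with
  | zero =>
    have hi : IntegrableOn (fun y : ℝ => Complex.exp (-w * y)) (Ioi 0) := by
      simpa using integrableOn_pow_mul_cexp 0 hw
    have hi' : IntegrableOn (fun y : ℝ => -w * Complex.exp (-w * y)) (Ioi 0) := hi.const_mul _
    have ht := tendsto_zero_of_hasDerivAt_of_integrableOn_Ioi (fun y _ => hexp y) hi' hi
    have h := integral_Ioi_of_hasDerivAt_of_tendsto' (fun y _ => hexp y) hi' ht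
    rw [integral_const_mul] at h
    simp only [pow_zero, one_mul, Nat.factorial_zero, Nat.cast_one, zero_add, pow_one]
    generalize ∫ y in Ioi (0 : ℝ), Complex.exp (-w * y) = J at h ⊢
    rw [eq_div_iff hw0]
    simp only [Complex.ofReal_zero, mul_zero, Complex.exp_zero] at h
    linear_combination -h
  | succ n ih =>
    have hd : ∀ y : ℝ, HasDerivAt (fun y : ℝ => (y : ℂ) ^ (n + 1) * Complex.exp (-w * y))
        (((n : ℂ) + 1) * ((y : ℂ) ^ n * Complex.exp (-w * y))
          + -w * ((y : ℂ) ^ (n + 1) * Complex.exp (-w * y))) y := by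
      intro y
      have := ((hasDerivAt_pow (n + 1) (y : ℂ)).comp_ofReal).mul (hexp y)
      refine this.congr_deriv ?_
      push_cast [Nat.add_sub_cancel]
      ring
    have h0 := (integrableOn_pow_mul_cexp n hw).const_mul ((n : ℂ) + 1)
    have h1 := (integrableOn_pow_mul_cexp (n + 1) hw).const_mul (-w)
    have ht := tendsto_zero_of_hasDerivAt_of_integrableOn_Ioi (fun y _ => hd y) (h0.add h1)
      (integrableOn_pow_mul_cexp (n + 1) hw)
    have h := integral_Ioi_of_hasDerivAt_of_tendsto' (fun y _ => hd y) (h0.add h1) ht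
    rw [integral_add h0 h1, integral_const_mul, integral_const_mul, ih] at h
    generalize ∫ y in Ioi (0 : ℝ), (y : ℂ) ^ (n + 1) * Complex.exp (-w * y) = J at h ⊢
    rw [eq_div_iff (pow_ne_zero _ hw0), Nat.factorial_succ]
    have hp := pow_ne_zero (n + 1) hw0
    simp only [Complex.ofReal_zero, ne_eq, Nat.add_eq_zero_iff, one_ne_zero, and_false,
      not_false_eq_true, zero_pow, zero_mul, sub_zero] at h
    field_simp at h
    push_cast
    rw [pow_succ _ (n + 1)]
    linear_combination -h

/-- Integrating monomials termwise produces the binomial expansion of (1 - 1/w)^m. The dependence on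
m is then geometric up to a factor cancelled in `lagTerm`. -/
theorem integral_lagPoly_mul_cexp (k m : ℕ) {w : ℂ} (hw : 0 < w.re) :
    ∫ y in Ioi (0 : ℝ), (y : ℂ) ^ k * Complex.exp (-w * y) * (((lagPoly k m).eval y : ℝ) : ℂ) =
      ((m + k).factorial : ℂ) / m.factorial * ((1 / w) ^ (k + 1) * (1 - 1 / w) ^ m) := by
  have hw0 : w ≠ 0 := fun h => by simp [h] at hw
  have h1 : ∀ y : ℝ, (y : ℂ) ^ k * Complex.exp (-w * y) * (((lagPoly k m).eval y : ℝ) : ℂ) =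
      ∑ j ∈ Finset.range (m + 1), ((m + k).choose (k + j) : ℂ) * ((-1) ^ j / (j.factorial : ℂ)) *
        ((y : ℂ) ^ (k + j) * Complex.exp (-w * y)) := by
    intro y
    rw [lagPoly_eval]
    push_cast
    rw [Finset.mul_sum]
    refine Finset.sum_congr rfl fun j _ => ?_
    rw [neg_pow (y : ℂ), pow_add]
    ring
  simp only [h1]
  rw [integral_finsetSum _ fun j _ => (integrableOn_pow_mul_cexp (k + j) hw).const_mul _]
  simp only [integral_const_mul, integral_pow_mul_cexp _ hw]
  rw [sub_eq_neg_add, add_pow, Finset.mul_sum, Finset.mul_sum]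
  refine Finset.sum_congr rfl fun j hj => ?_
  have hjm : j ≤ m := by simpa [Nat.lt_succ_iff] using hj
  have h2 : ((m + k).choose (k + j) : ℂ) * (k + j).factorial * (m - j).factorial
      = (m + k).factorial := by
    have := Nat.choose_mul_factorial_mul_factorial (show k + j ≤ m + k by omega)
    rw [show m + k - (k + j) = m - j by omega] at this
    exact_mod_cast this
  have h3 : (m.choose j : ℂ) * j.factorial * (m - j).factorial = m.factorial := by
    exact_mod_cast Nat.choose_mul_factorial_mul_factorial hjm
  have h4 : (m.factorial : ℂ) ≠ 0 := Nat.cast_ne_zero.2 (Nat.factorial_ne_zero _)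
  have h5 : (j.factorial : ℂ) ≠ 0 := Nat.cast_ne_zero.2 (Nat.factorial_ne_zero _)
  rw [one_pow, mul_one, neg_pow (1 / w), div_pow, div_pow, one_pow, one_pow,
    show k + j + 1 = (k + 1) + j by omega, pow_add _ (k + 1) j]
  have h6 : w ^ (k + 1) ≠ 0 := pow_ne_zero _ hw0
  have h7 : w ^ j ≠ 0 := pow_ne_zero _ hw0
  field_simp
  rw [← h2, ← h3]
  ring

/-! ### Laguerre expansions of test functions -/

theorem summable_add_one_pow_mul_geometric (n : ℕ) {r : ℝ} (hr0 : 0 ≤ r) (hr1 : r < 1) :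
    Summable fun m : ℕ => ((m : ℝ) + 1) ^ n * r ^ m := by
  have hr : ‖r‖ < 1 := by rwa [Real.norm_of_nonneg hr0]
  have h := (((summable_pow_mul_geometric_of_norm_lt_one n hr).add
    (summable_geometric_of_lt_one hr0 hr1)).mul_left (2 ^ (n - 1)))
  refine Summable.of_nonneg_of_le (fun m => by positivity) (fun m => ?_) h
  have := mul_le_mul_of_nonneg_right (add_pow_le (Nat.cast_nonneg (α := ℝ) m) zero_le_one n)
    (pow_nonneg hr0 m)
  rw [one_pow] at this
  linarith

/-- The generating function of the Laguerre coefficients of a test function is an integral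
transform of it. -/
theorem hasSum_lagCoeff_mul_pow {u : ℝ → ℂ} (hu : IsTestFn u) (k : ℕ) {t : ℂ} (ht : ‖t‖ < 1) :
    HasSum (fun m => lagCoeff k u m * t ^ m)
      (∫ x : ℝ, u x * ((1 / (1 - t) ^ (k + 1)) * Complex.exp (-x * (t / (1 - t))))) := by
  have hexp : Continuous fun x : ℝ => Real.exp (x / 2) := by fun_prop
  have h := hasSum_integral_of_norm_le_mul (μ := volume)
    (F := fun m (x : ℝ) => u x * (((lagPoly k m).eval x : ℝ) : ℂ) * t ^ m)
    (fun m => ((hu.integrable_mul (by fun_prop)).mul_const _).aestronglyMeasurable)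
    ((summable_add_one_pow_mul_geometric (k + 1) (norm_nonneg t) ht).mul_left (3 * 2 ^ (k + 1)))
    (hu.integrable_norm_mul hexp)
    (Filter.Eventually.of_forall fun x m => ?_)
    (Filter.Eventually.of_forall fun x =>
      ((hasSum_lagPoly_mul_pow k x ht).mul_left (u x)).congr_fun fun m => by ring)
  · simpa only [integral_mul_const, lagCoeff] using h
  · rcases le_or_gt x 0 with hx | hx
    · simp [hu.eq_zero_of_nonpos hx]
    · rw [norm_mul, norm_mul, Complex.norm_real, Real.norm_eq_abs, norm_pow]
      have := mul_le_mul_of_nonneg_left (abs_lagPoly_le k m hx.le)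
        (mul_nonneg (norm_nonneg (u x)) (pow_nonneg (norm_nonneg t) m))
      linarith

/-- The terms of the Laguerre series of a test function. -/
def lagTerm (k : ℕ) (u : ℝ → ℂ) (m : ℕ) (y : ℝ) : ℂ :=
  (m.factorial : ℂ) / (m + k).factorial * lagCoeff k u m *
    (((Real.exp (-y / 2) * (lagPoly k m).eval y : ℝ)) : ℂ)

theorem continuous_lagTerm (k : ℕ) (u : ℝ → ℂ) (m : ℕ) : Continuous (lagTerm k u m) := by
  unfold lagTerm
  fun_prop

/-- The factor exp(-y/2) in `lagTerm` cancels the exp(y/2) of the growth bound, so the estimate is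
uniform in y ≥ 0. Of the k + 1 + 2 powers of decay, k + 1 absorb the growth in m and 2 ensure
summability. -/
theorem exists_lagTerm_bound {u : ℝ → ℂ} (hu : IsTestFn u) (k : ℕ) :
    ∃ C : ℝ, 0 ≤ C ∧ ∀ m : ℕ, ∀ y : ℝ, 0 ≤ y → ‖lagTerm k u m y‖ ≤ C * (1 / ((m : ℝ) + 1) ^ 2) := by
  obtain ⟨C, hC0, hC⟩ := exists_lagCoeff_bound hu k (k + 1 + 2)
  refine ⟨C * (3 * 2 ^ (k + 1)), by positivity, fun m y hy => ?_⟩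
  have h1 : ‖(m.factorial : ℂ) / (m + k).factorial‖ ≤ 1 := by
    rw [norm_div, Complex.norm_natCast, Complex.norm_natCast]
    refine div_le_one_of_le₀ ?_ (by positivity)
    exact_mod_cast Nat.factorial_le (Nat.le_add_right m k)
  have h2 : ‖(((Real.exp (-y / 2) * (lagPoly k m).eval y : ℝ)) : ℂ)‖
      ≤ 3 * 2 ^ (k + 1) * ((m : ℝ) + 1) ^ (k + 1) := by
    rw [Complex.norm_real, norm_mul, Real.norm_of_nonneg (Real.exp_pos _).le, Real.norm_eq_abs]
    have := mul_le_mul_of_nonneg_left (abs_lagPoly_le k m hy) (Real.exp_pos (-y / 2)).le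
    refine this.trans (le_of_eq ?_)
    have he : Real.exp (-y / 2) * Real.exp (y / 2) = 1 := by
      rw [← Real.exp_add, neg_div, neg_add_cancel, Real.exp_zero]
    linear_combination (3 * 2 ^ (k + 1) * ((m : ℝ) + 1) ^ (k + 1)) * he
  have h3 := hC m
  have hm : 0 < (m : ℝ) + 1 := by positivity
  rw [lagTerm, norm_mul, norm_mul]
  calc _ ≤ 1 * ‖lagCoeff k u m‖ * (3 * 2 ^ (k + 1) * ((m : ℝ) + 1) ^ (k + 1)) := by gcongr
    _ = (‖lagCoeff k u m‖ * ((m : ℝ) + 1) ^ (k + 1 + 2)) * (3 * 2 ^ (k + 1)) *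
        (1 / ((m : ℝ) + 1) ^ 2) := by
      rw [pow_add _ (k + 1) 2]
      field_simp
    _ ≤ _ := by gcongr

theorem summable_lagTerm {u : ℝ → ℂ} (hu : IsTestFn u) (k : ℕ) {y : ℝ} (hy : 0 ≤ y) :
    Summable fun m => lagTerm k u m y := by
  obtain ⟨C, -, hC⟩ := exists_lagTerm_bound hu k
  exact Summable.of_norm_bounded (summable_one_div_add_one_sq.mul_left C) fun m => hC m y hy

theorem continuousOn_tsum_lagTerm {u : ℝ → ℂ} (hu : IsTestFn u) (k : ℕ) :
    ContinuousOn (fun y => ∑' m, lagTerm k u m y) (Ici 0) := by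
  obtain ⟨C, -, hC⟩ := exists_lagTerm_bound hu k
  exact continuousOn_tsum (fun m => (continuous_lagTerm k u m).continuousOn)
    (summable_one_div_add_one_sq.mul_left C) fun m y hy => hC m y hy

/-- The sum of the weighted Laguerre series of `u`, extended by zero to the real line. -/
def lagSeries (k : ℕ) (u : ℝ → ℂ) : ℝ → ℂ :=
  (Ioi 0).indicator fun y => ((y ^ k * Real.exp (-y / 2) : ℝ) : ℂ) * ∑' m, lagTerm k u m y

theorem integrable_lagSeries {u : ℝ → ℂ} (hu : IsTestFn u) (k : ℕ) :
    Integrable (lagSeries k u) := by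
  obtain ⟨C, -, hC⟩ := exists_lagTerm_bound hu k
  refine IntegrableOn.integrable_indicator ?_ measurableSet_Ioi
  have hs := summable_one_div_add_one_sq.mul_left C
  refine Integrable.mono' ((integrableOn_pow_mul_exp k one_half_pos).mul_const
    (∑' m : ℕ, C * (1 / ((m : ℝ) + 1) ^ 2))) ?_ ?_
  · refine ContinuousOn.aestronglyMeasurable ?_ measurableSet_Ioi
    exact Continuous.continuousOn (by fun_prop) |>.mul
      ((continuousOn_tsum_lagTerm hu k).mono Ioi_subset_Ici_self)
  · refine (ae_restrict_iff' measurableSet_Ioi).2 (Filter.Eventually.of_forall fun y hy => ?_)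
    have hy' : (0 : ℝ) < y := hy
    rw [norm_mul, Complex.norm_real, Real.norm_of_nonneg (by positivity),
      show -y / 2 = -(1 / 2) * y by ring]
    gcongr
    exact tsum_of_norm_bounded hs.hasSum fun m => hC m y hy'.le

/-- The Laguerre series of a test function has the same Fourier transform as the function. -/
theorem integral_exp_mul_lagSeries {u : ℝ → ℂ} (hu : IsTestFn u) (k : ℕ) (ξ : ℝ) :
    ∫ y : ℝ, Complex.exp (-(ξ * Complex.I) * y) * lagSeries k u y =
      ∫ y : ℝ, Complex.exp (-(ξ * Complex.I) * y) * u y := by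
  obtain ⟨C, -, hC⟩ := exists_lagTerm_bound hu k
  set w : ℂ := 1 + ξ * Complex.I with hw
  have hre : w.re = 1 := by simp [hw]
  have him : w.im = ξ := by simp [hw]
  have hw0 : w ≠ 0 := fun h => by simp [h] at hre
  -- This is |w - 1| < |w|, where w - 1 = iξ is w without its real part 1.
  have ht : ‖1 - 1 / w‖ < 1 := by
    rw [one_sub_div hw0, norm_div, div_lt_one (norm_pos_iff.2 hw0)]
    refine lt_of_pow_lt_pow_left₀ 2 (norm_nonneg _) ?_
    rw [Complex.sq_norm, Complex.sq_norm, Complex.normSq_apply, Complex.normSq_apply]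
    simp [hre]
  have h1 := hasSum_lagCoeff_mul_pow hu k ht
  have h2 := hasSum_integral_of_norm_le_mul (μ := volume.restrict (Ioi (0 : ℝ)))
    (F := fun m (y : ℝ) => Complex.exp (-(ξ * Complex.I) * y) *
      (((y ^ k * Real.exp (-y / 2) : ℝ) : ℂ) * lagTerm k u m y))
    (f := fun y : ℝ => Complex.exp (-(ξ * Complex.I) * y) *
      (((y ^ k * Real.exp (-y / 2) : ℝ) : ℂ) * ∑' m, lagTerm k u m y))
    (fun m => by
      have := continuous_lagTerm k u m
      exact Continuous.aestronglyMeasurable (by fun_prop))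
    (summable_one_div_add_one_sq.mul_left C) (integrableOn_pow_mul_exp k one_half_pos) ?_ ?_
  · have h3 : ∀ m, ∫ y in Ioi (0 : ℝ), Complex.exp (-(ξ * Complex.I) * y) *
        (((y ^ k * Real.exp (-y / 2) : ℝ) : ℂ) * lagTerm k u m y) =
        (1 / w) ^ (k + 1) * (lagCoeff k u m * (1 - 1 / w) ^ m) := by
      intro m
      have h4 : ∀ y : ℝ, Complex.exp (-(ξ * Complex.I) * y) *
        (((y ^ k * Real.exp (-y / 2) : ℝ) : ℂ) * lagTerm k u m y) =
          ((m.factorial : ℂ) / (m + k).factorial * lagCoeff k u m) *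
          ((y : ℂ) ^ k * Complex.exp (-w * y) * (((lagPoly k m).eval y : ℝ) : ℂ)) := by
        intro y
        have he : Complex.exp (-w * y) = Complex.exp (-(ξ * Complex.I) * y) *
            Complex.exp (-y / 2) * Complex.exp (-y / 2) := by
          rw [← Complex.exp_add, ← Complex.exp_add, hw]
          congr 1
          ring
        rw [lagTerm, he]
        push_cast
        ring
      simp only [h4]
      rw [integral_const_mul, integral_lagPoly_mul_cexp k m (by rw [hre]; exact one_pos)]
      have h5 : (m.factorial : ℂ) ≠ 0 := Nat.cast_ne_zero.2 (Nat.factorial_ne_zero _)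
      have h6 : ((m + k).factorial : ℂ) ≠ 0 := Nat.cast_ne_zero.2 (Nat.factorial_ne_zero _)
      field_simp
    simp only [h3] at h2
    have h7 := (h1.mul_left ((1 / w) ^ (k + 1))).unique h2
    have h8 : ∀ y : ℝ, Complex.exp (-(ξ * Complex.I) * y) * lagSeries k u y =
        (Ioi (0 : ℝ)).indicator (fun y : ℝ => Complex.exp (-(ξ * Complex.I) * y) *
      (((y ^ k * Real.exp (-y / 2) : ℝ) : ℂ) * ∑' m, lagTerm k u m y)) y := by
      intro y
      rw [lagSeries, indicator_apply, indicator_apply]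
      split_ifs <;> simp
    simp only [h8]
    rw [integral_indicator measurableSet_Ioi, ← h7, ← integral_const_mul]
    refine integral_congr_ae (Filter.Eventually.of_forall fun y => ?_)
    -- At t = 1 - 1/w the prefactor (1 - t)^(-(k+1)) cancels (1/w)^(k+1), and t/(1 - t) = w - 1 =
    -- iξ.
    have h9 : 1 - (1 - 1 / w) = 1 / w := by ring
    have h10 : (1 - 1 / w) / (1 / w) = ξ * Complex.I := by
      rw [one_sub_div hw0, div_div_div_cancel_right₀ hw0, div_one, hw]
      ring
    simp only [h9, h10]
    have h11 : (1 / w) ^ (k + 1) ≠ 0 := pow_ne_zero _ (one_div_ne_zero hw0)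
    rw [show -(y : ℂ) * (ξ * Complex.I) = -(ξ * Complex.I) * y by ring]
    field_simp
  · refine (ae_restrict_iff' measurableSet_Ioi).2 (Filter.Eventually.of_forall fun y hy m => ?_)
    have hy' : (0 : ℝ) < y := hy
    have hn : ‖Complex.exp (-(ξ * Complex.I) * y)‖ = 1 := by
      rw [Complex.norm_exp]
      simp
    rw [norm_mul, norm_mul, hn, one_mul, Complex.norm_real, Real.norm_of_nonneg (by positivity),
      show -y / 2 = -(1 / 2) * y by ring, mul_comm]
    gcongr
    exact hC m y hy'.le
  · refine (ae_restrict_iff' measurableSet_Ioi).2 (Filter.Eventually.of_forall fun y hy => ?_)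
    exact ((summable_lagTerm hu k (le_of_lt hy)).hasSum.mul_left _).mul_left _

-- The difference of the two sides is integrable with zero Fourier transform, so inversion makes it
-- vanish wherever it is continuous, in particular at every y > 0.
open scoped FourierTransform in
theorem lagSeries_eq {u : ℝ → ℂ} (hu : IsTestFn u) (k : ℕ) {y : ℝ} (hy : 0 < y) :
    lagSeries k u y = u y := by
  have hui : Integrable u := by simpa using hu.integrable_mul (g := fun _ => 1) continuous_const
  have hexp : ∀ (ξ : ℝ) {f : ℝ → ℂ}, Integrable f →
      Integrable fun y : ℝ => Complex.exp (-(ξ * Complex.I) * y) * f y := by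
    intro ξ f hf
    refine hf.bdd_mul (c := 1) (Continuous.aestronglyMeasurable (by fun_prop))
      (Filter.Eventually.of_forall fun y => ?_)
    rw [Complex.norm_exp]
    simp
  have hF : 𝓕 (fun y => lagSeries k u y - u y) = 0 := by
    funext ξ
    rw [Real.fourier_real_eq_integral_exp_smul, Pi.zero_apply]
    have h1 : ∀ v : ℝ, Complex.exp (((-2 * Real.pi * v * ξ : ℝ) : ℂ) * Complex.I) •
        (lagSeries k u v - u v) =
        Complex.exp (-(((2 * Real.pi * ξ : ℝ) : ℂ) * Complex.I) * v) * lagSeries k u v -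
        Complex.exp (-(((2 * Real.pi * ξ : ℝ) : ℂ) * Complex.I) * v) * u v := by
      intro v
      rw [smul_eq_mul, mul_sub]
      congr 3 <;> (push_cast; ring)
    simp only [h1]
    rw [integral_sub (hexp _ (integrable_lagSeries hu k)) (hexp _ hui),
      integral_exp_mul_lagSeries hu, sub_self]
  have hcont : ContinuousAt (fun y => lagSeries k u y - u y) y := by
    refine ContinuousAt.sub ?_ hu.continuous.continuousAt
    have h2 : ContinuousOn (lagSeries k u) (Ioi 0) := by
      refine ContinuousOn.congr (f := fun y : ℝ => ((y ^ k * Real.exp (-y / 2) : ℝ) : ℂ) *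
        ∑' m, lagTerm k u m y) ?_ fun y hy => indicator_of_mem hy _
      exact Continuous.continuousOn (by fun_prop) |>.mul
        ((continuousOn_tsum_lagTerm hu k).mono Ioi_subset_Ici_self)
    exact h2.continuousAt (Ioi_mem_nhds hy)
  have hinv := ((integrable_lagSeries hu k).sub hui).fourierInv_fourier_eq
    (by rw [show lagSeries k u - u = fun y => lagSeries k u y - u y from rfl, hF]
        exact integrable_zero _ _ _) hcont
  rw [show lagSeries k u - u = fun y => lagSeries k u y - u y from rfl, hF,
    Real.fourierInv_eq] at hinv
  simp only [Pi.zero_apply, smul_zero, integral_zero] at hinv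
  exact (sub_eq_zero.1 hinv.symm)

theorem tsum_lagTerm_mul {u : ℝ → ℂ} (hu : IsTestFn u) (k : ℕ) {y : ℝ} (hy : 0 < y) :
    ((y ^ k * Real.exp (-y / 2) : ℝ) : ℂ) * ∑' m, lagTerm k u m y = u y := by
  rw [← lagSeries_eq hu k hy, lagSeries, indicator_of_mem (mem_Ioi.2 hy)]

/-- The series is continuous up to 0 and u vanishes near 0. This supplies the boundary value needed
for the weight λ = 0. -/
theorem tsum_lagTerm_zero {u : ℝ → ℂ} (hu : IsTestFn u) (k : ℕ) :
    ∑' m, lagTerm k u m 0 = 0 := by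
  have h1 : Filter.Tendsto (fun y => ∑' m, lagTerm k u m y) (nhdsWithin 0 (Ioi 0))
      (nhds (∑' m, lagTerm k u m 0)) :=
    (continuousOn_tsum_lagTerm hu k 0 self_mem_Ici).mono_left
      (nhdsWithin_mono _ Ioi_subset_Ici_self)
  refine tendsto_nhds_unique h1 (tendsto_const_nhds.congr' ?_)
  have h0 : (0 : ℝ) ∉ tsupport u := fun h => lt_irrefl _ (mem_Ioi.1 (hu.2.2 h))
  filter_upwards [self_mem_nhdsWithin,
    nhdsWithin_le_nhds ((isClosed_tsupport u).isOpen_compl.mem_nhds h0)] with y hy hyu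
  have h2 := tsum_lagTerm_mul hu k hy
  rw [image_eq_zero_of_notMem_tsupport hyu] at h2
  have hy' : (0 : ℝ) < y := hy
  have h3 : ((y ^ k * Real.exp (-y / 2) : ℝ) : ℂ) ≠ 0 := by
    exact_mod_cast (by positivity : 0 < y ^ k * Real.exp (-y / 2)).ne'
  exact ((mul_eq_zero.1 h2).resolve_left h3).symm

/-! ### Expansions in Laguerre functions -/

/-- The coefficient of `φ` with respect to a Laguerre function. -/
def lagFunCoeff (k : ℕ) (φ : ℝ → ℂ) (m : ℕ) : ℂ := ∫ x, φ x * (lagFun k m x : ℂ)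

theorem IsTestFn.mul_weight {φ : ℝ → ℂ} (h : IsTestFn φ) (k : ℕ) :
    IsTestFn fun x => φ x * ((Real.sqrt x ^ k * Real.exp (-x / 2) : ℝ) : ℂ) := by
  refine h.mul_contDiffOn (Complex.ofRealCLM.contDiff.comp_contDiffOn ?_)
  refine ContDiffOn.mul (ContDiffOn.pow ?_ k) (ContDiff.contDiffOn (by fun_prop))
  exact contDiffOn_id.sqrt fun x hx => (ne_of_gt hx)

theorem lagFunCoeff_eq (k : ℕ) (φ : ℝ → ℂ) (m : ℕ) :
    lagFunCoeff k φ m = ((Real.sqrt (m.factorial / (m + k).factorial) : ℝ) : ℂ) *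
      lagCoeff k (fun x => φ x * ((Real.sqrt x ^ k * Real.exp (-x / 2) : ℝ) : ℂ)) m := by
  rw [lagFunCoeff, lagCoeff, ← integral_const_mul]
  refine integral_congr_ae (Filter.Eventually.of_forall fun x => ?_)
  simp only [lagFun]
  push_cast
  ring

theorem lagFun_mul_lagFunCoeff (k : ℕ) (φ : ℝ → ℂ) (m : ℕ) (y : ℝ) :
    (lagFun k m y : ℂ) * lagFunCoeff k φ m = ((Real.sqrt y ^ k : ℝ) : ℂ) *
      lagTerm k (fun x => φ x * ((Real.sqrt x ^ k * Real.exp (-x / 2) : ℝ) : ℂ)) m y := by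
  have h : ((Real.sqrt (m.factorial / (m + k).factorial) : ℝ) : ℂ) *
      ((Real.sqrt (m.factorial / (m + k).factorial) : ℝ) : ℂ)
      = (m.factorial : ℂ) / (m + k).factorial := by
    rw [← Complex.ofReal_mul, Real.mul_self_sqrt (by positivity)]
    push_cast
    rfl
  rw [lagFunCoeff_eq, lagFun, lagTerm, ← h]
  push_cast
  ring

/-- The Laguerre expansion of a test function converges to it at every point of `[0, ∞)`. -/
theorem hasSum_lagFun_mul_lagFunCoeff {φ : ℝ → ℂ} (h : IsTestFn φ) (k : ℕ) {y : ℝ} (hy : 0 ≤ y) :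
    HasSum (fun m => (lagFun k m y : ℂ) * lagFunCoeff k φ m) (φ y) := by
  have hu := h.mul_weight k
  simp only [lagFun_mul_lagFunCoeff]
  have hs := ((summable_lagTerm hu k hy).hasSum).mul_left ((Real.sqrt y ^ k : ℝ) : ℂ)
  suffices hval : φ y = ((Real.sqrt y ^ k : ℝ) : ℂ) * ∑' m, lagTerm k
      (fun x => φ x * ((Real.sqrt x ^ k * Real.exp (-x / 2) : ℝ) : ℂ)) m y by
    rw [hval]
    exact hs
  rcases hy.eq_or_lt with rfl | hy
  · rw [tsum_lagTerm_zero hu, mul_zero, h.eq_zero_of_nonpos le_rfl]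
  · have h1 := tsum_lagTerm_mul hu k hy
    have h2 : y ^ k = Real.sqrt y ^ k * Real.sqrt y ^ k := by
      rw [← mul_pow, Real.mul_self_sqrt hy.le]
    have h3 : ((Real.sqrt y ^ k * Real.exp (-y / 2) : ℝ) : ℂ) ≠ 0 := by
      exact_mod_cast (by positivity : 0 < Real.sqrt y ^ k * Real.exp (-y / 2)).ne'
    refine mul_right_cancel₀ h3 ?_
    rw [← h1, h2]
    push_cast
    ring

theorem summable_norm_lagFunCoeff {φ : ℝ → ℂ} (h : IsTestFn φ) (k : ℕ) :
    Summable fun m => ‖lagFunCoeff k φ m‖ := by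
  obtain ⟨C, -, hC⟩ := exists_lagCoeff_bound (h.mul_weight k) k 2
  refine Summable.of_nonneg_of_le (fun m => norm_nonneg _) (fun m => ?_)
    (summable_one_div_add_one_sq.mul_left C)
  have h1 : ‖((Real.sqrt (m.factorial / (m + k).factorial) : ℝ) : ℂ)‖ ≤ 1 := by
    rw [Complex.norm_real, Real.norm_of_nonneg (Real.sqrt_nonneg _), Real.sqrt_le_one]
    refine div_le_one_of_le₀ ?_ (by positivity)
    exact_mod_cast Nat.factorial_le (Nat.le_add_right m k)
  have hm : 0 < ((m : ℝ) + 1) ^ 2 := by positivity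
  rw [lagFunCoeff_eq, norm_mul, mul_one_div, le_div_iff₀ hm]
  refine le_trans ?_ (hC m)
  gcongr
  exact mul_le_of_le_one_left (norm_nonneg _) h1

/-- Parseval's identity for the Laguerre expansions of test functions. -/
theorem hasSum_conj_lagFunCoeff_mul {φ ψ : ℝ → ℂ} (hφ : IsTestFn φ) (hψ : IsTestFn ψ) (k : ℕ) :
    HasSum (fun m => (starRingEnd ℂ) (lagFunCoeff k φ m) * lagFunCoeff k ψ m)
      (∫ x, (starRingEnd ℂ) (φ x) * ψ x) := by
  obtain ⟨C, -, hC⟩ := exists_lagTerm_bound (hψ.mul_weight k) k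
  have h := hasSum_integral_of_norm_le_mul (μ := volume)
    (F := fun m x => (starRingEnd ℂ) (φ x) * ((lagFun k m x : ℂ) * lagFunCoeff k ψ m))
    (f := fun x => (starRingEnd ℂ) (φ x) * ψ x) (g := fun x => ‖φ x‖ * Real.sqrt x ^ k)
    (fun m => by
      have := continuous_lagFun k m
      exact (hφ.conj.integrable_mul (by fun_prop)).aestronglyMeasurable)
    (summable_one_div_add_one_sq.mul_left C) (hφ.integrable_norm_mul (by fun_prop))
    (Filter.Eventually.of_forall fun x m => ?_) (Filter.Eventually.of_forall fun x => ?_)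
  · refine h.congr_fun fun m => ?_
    rw [lagFunCoeff, ← integral_conj, ← integral_mul_const]
    refine integral_congr_ae (Filter.Eventually.of_forall fun x => ?_)
    simp only [map_mul, Complex.conj_ofReal]
    ring
  · rcases le_or_gt x 0 with hx | hx
    · simp [hφ.eq_zero_of_nonpos hx]
    · rw [lagFun_mul_lagFunCoeff, norm_mul, norm_mul, RCLike.norm_conj, Complex.norm_real,
        Real.norm_of_nonneg (by positivity)]
      have := mul_le_mul_of_nonneg_left (hC m x hx.le)
        (mul_nonneg (norm_nonneg (φ x)) (pow_nonneg (Real.sqrt_nonneg x) k))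
      linarith
  · rcases le_or_gt x 0 with hx | hx
    · simp only [hφ.eq_zero_of_nonpos hx, map_zero, zero_mul]
      exact hasSum_zero
    · exact (hasSum_lagFun_mul_lagFunCoeff hψ k hx.le).mul_left _

/-! ### Smeared matrix elements -/

theorem conj_I_pow_mul_I_pow (j : ℕ) : (starRingEnd ℂ) (Complex.I ^ j) * Complex.I ^ j = 1 := by
  rw [map_pow, ← mul_pow, Complex.conj_I, neg_mul, Complex.I_mul_I, neg_neg, one_pow]

/-- The smeared matrix element `⟨m + k| D_k[φ] |m⟩`. -/
def smearCoeff (k : ℤ) (φ : ℝ → ℂ) (m : ℕ) : ℂ :=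
  4 * (Complex.I ^ k.natAbs * ∫ x, φ (4 * x) * (entry k m x : ℂ))

theorem integral_mul_entry (k : ℤ) (φ : ℝ → ℂ) (m : ℕ) :
    ∫ x, φ x * (entry k m x : ℂ) = if 0 ≤ (m : ℤ) + k then
      lagFunCoeff k.natAbs φ (min m ((m : ℤ) + k).toNat) else 0 := by
  unfold entry lagFunCoeff
  split_ifs <;> simp

/-- The substitution s = 4x is the source of the factor 4 in the theorem. -/
theorem integral_mul_entry_sqrt {φ : ℝ → ℂ} (h : IsTestFn φ) (k : ℤ) (m : ℕ) :
    ∫ s in Ioi (0 : ℝ), φ s * (entry k m (Real.sqrt s ^ 2 / 4) : ℂ) =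
      4 * ∫ x, φ (4 * x) * (entry k m x : ℂ) := by
  have h1 := integral_comp_mul_left_Ioi (fun s => φ s * (entry k m (s / 4) : ℂ)) 0
    (show (0 : ℝ) < 4 by norm_num)
  have h2 := (h.comp_mul_left (show (0 : ℝ) < 4 by norm_num)).setIntegral_eq
    fun x => (entry k m x : ℂ)
  have h3 : ∀ x : ℝ, 4 * x / 4 = x := fun x => by ring
  simp only [h3, mul_zero] at h1
  rw [← h2, h1, Complex.real_smul]
  push_cast
  rw [mul_inv_cancel_left₀ (by norm_num : (4 : ℂ) ≠ 0)]
  refine setIntegral_congr_fun measurableSet_Ioi fun s hs => ?_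
  simp only [Real.sq_sqrt (le_of_lt hs)]

theorem integrableOn_mul_entry_sqrt {φ : ℝ → ℂ} (h : IsTestFn φ) (k : ℤ) (m : ℕ) :
    IntegrableOn (fun s => φ s * (entry k m (Real.sqrt s ^ 2 / 4) : ℂ)) (Ioi 0) := by
  have := continuous_entry k m
  exact (h.integrable_mul (by fun_prop)).integrableOn

theorem summable_norm_smearCoeff {φ : ℝ → ℂ} (h : IsTestFn φ) (k : ℤ) :
    Summable fun m => ‖smearCoeff k φ m‖ := by
  have h4 := h.comp_mul_left (show (0 : ℝ) < 4 by norm_num)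
  have hs := (hasSum_diagonal k (summable_norm_lagFunCoeff h4 k.natAbs).hasSum).mul_left 4
  refine hs.summable.congr fun m => ?_
  rw [smearCoeff, integral_mul_entry k fun x => φ (4 * x)]
  split_ifs <;> simp

theorem hasSum_conj_smearCoeff_mul {φ ψ : ℝ → ℂ} (hφ : IsTestFn φ) (hψ : IsTestFn ψ) (k : ℤ) :
    HasSum (fun m => (starRingEnd ℂ) (smearCoeff k φ m) * smearCoeff k ψ m)
      (4 * ∫ s in Ioi (0 : ℝ), (starRingEnd ℂ) (φ s) * ψ s) := by
  have four_pos' : (0 : ℝ) < 4 := by norm_num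
  have hφ4 := hφ.comp_mul_left four_pos'
  -- The 16 collects a factor 4 from each smeared entry; substituting back to s returns 1/4 and
  -- leaves 4.
  have h := (hasSum_diagonal k (hasSum_conj_lagFunCoeff_mul hφ4 (hψ.comp_mul_left four_pos')
    k.natAbs)).mul_left 16
  have h1 := integral_comp_mul_left_Ioi (fun s => (starRingEnd ℂ) (φ s) * ψ s) 0 four_pos'
  rw [mul_zero, hφ4.conj.setIntegral_eq, Complex.real_smul] at h1
  have hval : (4 * ∫ s in Ioi (0 : ℝ), (starRingEnd ℂ) (φ s) * ψ s) =
      16 * ∫ x, (starRingEnd ℂ) (φ (4 * x)) * ψ (4 * x) := by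
    rw [h1]
    push_cast
    ring
  rw [hval]
  refine h.congr_fun fun m => ?_
  have hI := conj_I_pow_mul_I_pow k.natAbs
  rw [smearCoeff, smearCoeff, integral_mul_entry k fun x => φ (4 * x),
    integral_mul_entry k fun x => ψ (4 * x)]
  split_ifs
  · simp only [map_mul, map_ofNat]
    linear_combination (16 * (starRingEnd ℂ) (lagFunCoeff k.natAbs (fun x => φ (4 * x))
      (min m ((m : ℤ) + k).toNat)) * lagFunCoeff k.natAbs (fun x => ψ (4 * x))
      (min m ((m : ℤ) + k).toNat)) * hI
  · simp

/-! ### Operators on the Hilbert space -/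

section

variable {X : Type*} [NormedAddCommGroup X] [InnerProductSpace ℂ X] (e : HilbertBasis ℕ ℂ X)

theorem toX_single (m : ℕ) (c : ℂ) : toX e (Finsupp.single m c) = c • e m := by
  simp [toX]

theorem toX_D_single (k : ℤ) (l : ℝ) (m : ℕ) :
    toX e (D k l (Finsupp.single m 1)) =
      (Complex.I ^ k.natAbs * (entry k m (l ^ 2 / 4) : ℂ)) • e ((m : ℤ) + k).toNat := by
  rw [D_single, toX_single]

theorem inner_smul_basis_self (a b : ℂ) (i : ℕ) :
    ⟪a • e i, b • e i⟫_ℂ = (starRingEnd ℂ) a * b := by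
  rw [inner_smul_left, inner_smul_right, inner_self_eq_norm_sq_to_K, e.orthonormal.1]
  simp

theorem traceTerm_self (k : ℤ) (l l' : ℝ) (m : ℕ) :
    traceTerm e k k l l' m = (entry k m (l ^ 2 / 4) : ℂ) * (entry k m (l' ^ 2 / 4) : ℂ) := by
  have hI := conj_I_pow_mul_I_pow k.natAbs
  rw [traceTerm, toX_D_single, toX_D_single, inner_smul_basis_self, map_mul, Complex.conj_ofReal]
  linear_combination (entry k m (l ^ 2 / 4) : ℂ) * (entry k m (l' ^ 2 / 4) : ℂ) * hI

/-- Distinct shifts send |m⟩ to orthogonal basis vectors; if either index is truncated at 0, its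
entry vanishes. -/
theorem traceTerm_of_ne {k n : ℤ} (h : k ≠ n) (l l' : ℝ) (m : ℕ) :
    traceTerm e k n l l' m = 0 := by
  rw [traceTerm, toX_D_single, toX_D_single]
  by_cases hk : 0 ≤ (m : ℤ) + k
  · by_cases hn : 0 ≤ (m : ℤ) + n
    · rw [inner_smul_left, inner_smul_right, e.orthonormal.2 (by omega), mul_zero, mul_zero]
    · simp [entry, hn]
  · simp [entry, hk]

theorem integral_traceTerm {φ : ℝ → ℂ} (h : IsTestFn φ) (k : ℤ) (l : ℝ) (m : ℕ) :
    IntegrableOn (fun s : ℝ => φ s * traceTerm e k k l (Real.sqrt s) m) (Ioi 0) ∧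
    ∫ s in Ioi (0 : ℝ), φ s * traceTerm e k k l (Real.sqrt s) m =
      4 * if 0 ≤ (m : ℤ) + k then
        (lagFun k.natAbs (min m ((m : ℤ) + k).toNat) (l ^ 2 / 4) : ℂ) *
          lagFunCoeff k.natAbs (fun x => φ (4 * x)) (min m ((m : ℤ) + k).toNat) else 0 := by
  have h1 : ∀ s : ℝ, φ s * traceTerm e k k l (Real.sqrt s) m = (entry k m (l ^ 2 / 4) : ℂ) *
      (φ s * (entry k m (Real.sqrt s ^ 2 / 4) : ℂ)) := fun s => by
    rw [traceTerm_self]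
    ring
  simp only [h1]
  refine ⟨(integrableOn_mul_entry_sqrt h k m).const_mul _, ?_⟩
  rw [integral_const_mul, integral_mul_entry_sqrt h,
    integral_mul_entry k (fun x => φ (4 * x)), entry]
  split_ifs
  · ring
  · simp

theorem hasSum_integral_traceTerm {φ : ℝ → ℂ} (h : IsTestFn φ) (k : ℤ) (l : ℝ) :
    HasSum (fun m : ℕ => ∫ s in Ioi (0 : ℝ), φ s * traceTerm e k k l (Real.sqrt s) m)
      (4 * φ (l ^ 2)) := by
  simp only [fun m => (integral_traceTerm e h k l m).2]
  have h4 := h.comp_mul_left (show (0 : ℝ) < 4 by norm_num)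
  have hs := hasSum_lagFun_mul_lagFunCoeff h4 k.natAbs (show 0 ≤ l ^ 2 / 4 by positivity)
  rw [show 4 * (l ^ 2 / 4) = l ^ 2 by ring] at hs
  exact (hasSum_diagonal k hs).mul_left 4

variable [CompleteSpace X]

theorem integral_smul_toX_D_single {φ : ℝ → ℂ} (h : IsTestFn φ) (k : ℤ) (m : ℕ) (c : ℂ) :
    IntegrableOn (fun s : ℝ => φ s • toX e (D k (Real.sqrt s) (Finsupp.single m c))) (Ioi 0) ∧
    ∫ s in Ioi (0 : ℝ), φ s • toX e (D k (Real.sqrt s) (Finsupp.single m c)) =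
      (c * smearCoeff k φ m) • e ((m : ℤ) + k).toNat := by
  have h1 : ∀ s : ℝ, φ s • toX e (D k (Real.sqrt s) (Finsupp.single m c)) =
      (c * Complex.I ^ k.natAbs * (φ s * (entry k m (Real.sqrt s ^ 2 / 4) : ℂ))) •
        e ((m : ℤ) + k).toNat := by
    intro s
    have h2 : Finsupp.single m c = c • Finsupp.single m (1 : ℂ) := by simp
    rw [h2, map_smul, map_smul, toX_D_single, smul_smul, smul_smul]
    congr 1
    ring
  simp only [h1]
  refine ⟨((integrableOn_mul_entry_sqrt h k m).const_mul _).smul_const _, ?_⟩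
  rw [integral_smul_const, integral_const_mul, integral_mul_entry_sqrt h, smearCoeff]
  congr 1
  ring

variable {e}

theorem IsSmeared.apply_basis {k : ℤ} {φ : ℝ → ℂ} {A : X →L[ℂ] X} (hA : IsSmeared e k φ A)
    (h : IsTestFn φ) (m : ℕ) : A (e m) = smearCoeff k φ m • e ((m : ℤ) + k).toNat := by
  have h1 := (hA (Finsupp.single m 1)).2
  rwa [(integral_smul_toX_D_single e h k m 1).2, toX_single, one_smul, one_mul] at h1

theorem isSmeared_of_apply_basis {k : ℤ} {φ : ℝ → ℂ} {A : X →L[ℂ] X} (h : IsTestFn φ)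
    (hA : ∀ m, A (e m) = smearCoeff k φ m • e ((m : ℤ) + k).toNat) : IsSmeared e k φ A := by
  intro v
  induction v using Finsupp.induction_linear with
  | zero => simp
  | add v w hv hw =>
    simp only [map_add, smul_add]
    exact ⟨hv.1.add hw.1, by rw [hv.2, hw.2, integral_add hv.1 hw.1]⟩
  | single m c =>
    obtain ⟨h1, h2⟩ := integral_smul_toX_D_single e h k m c
    refine ⟨h1, ?_⟩
    rw [h2, toX_single, map_smul, hA, smul_smul]

theorem IsSmeared.hasTraceInner {k n : ℤ} {φ ψ : ℝ → ℂ} {A B : X →L[ℂ] X} (hφ : IsTestFn φ)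
    (hψ : IsTestFn ψ) (hA : IsSmeared e k φ A) (hB : IsSmeared e n ψ B) :
    HasTraceInner e A B
      (if k = n then 4 * ∫ s in Ioi (0 : ℝ), (starRingEnd ℂ) (φ s) * ψ s else 0) := by
  have h1 : ∀ m, ⟪e m, (ContinuousLinearMap.adjoint A ∘L B) (e m)⟫_ℂ =
      if k = n then (starRingEnd ℂ) (smearCoeff k φ m) * smearCoeff n ψ m else 0 := by
    intro m
    rw [ContinuousLinearMap.comp_apply, ContinuousLinearMap.adjoint_inner_right,
      hA.apply_basis hφ, hB.apply_basis hψ]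
    split_ifs with hkn
    · rw [hkn, inner_smul_basis_self]
    · by_cases hk : 0 ≤ (m : ℤ) + k
      · by_cases hn : 0 ≤ (m : ℤ) + n
        · rw [inner_smul_left, inner_smul_right, e.orthonormal.2 (by omega), mul_zero, mul_zero]
        · simp [smearCoeff, entry, hn]
      · simp [smearCoeff, entry, hk]
  unfold HasTraceInner
  simp only [h1]
  split_ifs with hkn
  · subst hkn
    exact hasSum_conj_smearCoeff_mul hφ hψ k
  · exact hasSum_zero

/-- The diagonal terms of A*A are ‖A e_m‖², so the real part of the convergent trace is the
Hilbert–Schmidt sum. -/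
theorem HasTraceInner.memK {A : X →L[ℂ] X} {c : ℂ} (h : HasTraceInner e A A c) : MemK e A := by
  refine (h.mapL Complex.reCLM).summable.congr fun m => ?_
  rw [ContinuousLinearMap.comp_apply, ContinuousLinearMap.adjoint_inner_right,
    inner_self_eq_norm_sq_to_K, Complex.reCLM_apply]
  norm_cast

variable (e) in
/-- A bounded operator with prescribed absolutely summable entries. -/
theorem exists_apply_basis {c : ℕ → ℂ} (hc : Summable fun m => ‖c m‖) (t : ℕ → ℕ) :
    ∃ A : X →L[ℂ] X, ∀ m, A (e m) = c m • e (t m) := by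
  -- The m-th summand is a rank-one operator of norm |c m|, so the series converges in operator
  -- norm.
  have hs : Summable fun m => c m • (innerSL ℂ (e m)).smulRight (e (t m)) := by
    refine Summable.of_norm (hc.congr fun m => ?_)
    rw [norm_smul, ContinuousLinearMap.norm_smulRight_apply, innerSL_apply_norm, e.orthonormal.1,
      e.orthonormal.1, mul_one, mul_one]
  refine ⟨∑' m, c m • (innerSL ℂ (e m)).smulRight (e (t m)), fun m => ?_⟩
  have h1 := hs.hasSum.mapL (ContinuousLinearMap.apply ℂ X (e m))
  refine h1.unique ?_
  have h2 := hasSum_single (f := fun i => ContinuousLinearMap.apply ℂ X (e m)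
    (c i • (innerSL ℂ (e i)).smulRight (e (t i)))) m fun i hi => by
      simp [e.orthonormal.2 hi]
  convert h2 using 1
  simp [inner_self_eq_norm_sq_to_K, e.orthonormal.1 m]

/-- The smearing condition fixes A on every basis vector, and the basis has dense span; membership
in K is Parseval's identity for φ with itself. -/
theorem existsUnique_isSmeared {φ : ℝ → ℂ} (h : IsTestFn φ) (k : ℤ) :
    ∃! A : X →L[ℂ] X, IsSmeared e k φ A ∧ MemK e A := by
  obtain ⟨A, hA⟩ := exists_apply_basis e (summable_norm_smearCoeff h k)
    fun m => ((m : ℤ) + k).toNat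
  have hAs := isSmeared_of_apply_basis h hA
  refine ⟨A, ⟨hAs, (hAs.hasTraceInner h h hAs).memK⟩, fun B hB => ?_⟩
  refine ContinuousLinearMap.ext_on (s := Set.range e) ?_ ?_
  · exact Submodule.dense_iff_topologicalClosure_eq_top.2 e.dense_span
  · rintro _ ⟨m, rfl⟩
    rw [hA, hB.1.apply_basis h]

end

end Heisenberg

end

theorem mainTheorem4 {X : Type*} [NormedAddCommGroup X] [InnerProductSpace ℂ X] [CompleteSpace X]
    (e : HilbertBasis ℕ ℂ X) :
    -- orthogonality in the index, for all values of the weights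
    (∀ (k n : ℤ) (l l' : ℝ), k ≠ n → HasSum (Heisenberg.traceTerm e k n l l') 0) ∧
    -- the trace is a delta distribution in the squared weight, the other weight being fixed
    (∀ (k n : ℤ) (l : ℝ) (φ : ℝ → ℂ), Heisenberg.IsTestFn φ →
      (∀ m : ℕ, IntegrableOn
        (fun s : ℝ => φ s * Heisenberg.traceTerm e k n l (Real.sqrt s) m) (Ioi 0)) ∧
      HasSum
        (fun m : ℕ => ∫ s in Ioi (0 : ℝ), φ s * Heisenberg.traceTerm e k n l (Real.sqrt s) m)
        (if k = n then 4 * φ (l ^ 2) else 0)) ∧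
    -- the smeared basis elements exist and lie in the Hilbert space with the trace inner product
    (∀ (k : ℤ) (φ : ℝ → ℂ), Heisenberg.IsTestFn φ →
      ∃! A : X →L[ℂ] X, Heisenberg.IsSmeared e k φ A ∧ Heisenberg.MemK e A) ∧
    -- their trace inner products are given by the delta kernel
    (∀ (k n : ℤ) (φ ψ : ℝ → ℂ) (A B : X →L[ℂ] X),
      Heisenberg.IsTestFn φ → Heisenberg.IsTestFn ψ →
      Heisenberg.IsSmeared e k φ A → Heisenberg.IsSmeared e n ψ B →
      Heisenberg.HasTraceInner e A B
        (if k = n then 4 * ∫ s in Ioi (0 : ℝ), (starRingEnd ℂ) (φ s) * ψ s else 0)) := by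
  refine ⟨fun k n l l' hkn => ?_, fun k n l φ hφ => ?_,
    fun k φ hφ => Heisenberg.existsUnique_isSmeared hφ k,
    fun k n φ ψ A B hφ hψ hA hB => hA.hasTraceInner hφ hψ hB⟩
  · exact hasSum_zero.congr_fun fun m => Heisenberg.traceTerm_of_ne e hkn l l' m
  · split_ifs with hkn
    · subst hkn
      exact ⟨fun m => (Heisenberg.integral_traceTerm e hφ k l m).1,
        Heisenberg.hasSum_integral_traceTerm e hφ k l⟩
    · simp only [Heisenberg.traceTerm_of_ne e hkn, mul_zero, integral_zero]
      exact ⟨fun _ => integrableOn_zero, hasSum_zero⟩
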